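/- Let $d\ge 1$, let $(M_1,\mathfrak g)$ and $(M_2,\mathfrak h)$ be smooth, oriented $d$-dimensional Riemannian manifolds (Hausdorff, second countable, without boundary), and let $f:M_1\to M_2$ be of class $C^2$. *Intrinsic notions.* For a linear map $A:V\to W$ between oriented $d$-dimensional inner-product spaces let $\operatorname{Cof}A=(-1)^{d-1}\star_W^{d-1}\circ\Lambda^{d-1}A\circ\star_V^1$, with $\star$ the Hodge star on multivectors. Let $\nabla^{f^*TM_2}$ be the connection on $f^*TM_2$ induced by the Levi-Civita connection of $M_2$, and $\delta_{\nabla^{f^*TM_2}}$ its formal adjoint. For $U\subseteq M_1$ open, the Riemannian Piola identity on $U$ is $\delta_{\nabla^{f^*TM_2}}\operatorname{Cof}df=0$ on $U$, that is, $$\int_{M_1}\langle \operatorname{Cof}df,\nabla^{f^*TM_2}\xi\rangle_{\mathfrak g,\mathfrak h}\,d\mathrm{Vol}_1=0$$ for every $C^1$ section $\xi$ of $f^*TM_2$ with compact support in $U$. *Coordinates.* Let $x$ be a smooth chart of $M_1$ and $y$ a smooth chart of $M_2$, and let $U=\operatorname{dom}x\cap f^{-1}(\operatorname{dom}y)$.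 Write $f^\alpha$ for the components of $y\circ f\circ x^{-1}$ on $x(U)$, $[df]=(\partial_if^\alpha)$ for its Jacobian matrix, $\operatorname{cof}[df]$ for the matrix cofactor (the transpose of the adjugate), $|\mathfrak h|$ for the determinant of the matrix $(\mathfrak h_{\alpha\beta})$ of the metric of $M_2$ in the chart $y$, $\Gamma^\alpha_{\beta\gamma}$ for its Christoffel symbols, and $|f^*\mathfrak h|$, $f^*\Gamma^\alpha_{\beta\gamma}$ for the compositions of these functions with $y\circ f\circ x^{-1}$. Repeated indices are summed. 1. For all charts $x,y$, the Riemannian Piola identity on $U$ is equivalent to the validity on $x(U)$, for all $\gamma$, of $$-\frac1{|f^*\mathfrak h|^{1/2}}\,\partial_j\Big((\operatorname{cof}[df]^T)^j_\gamma\,|f^*\mathfrak h|^{1/2}\Big)+(f^*\Gamma^\beta_{\beta\gamma})\det[df]=0.\tag{A}$$ Moreover, if $x$ and $y$ are positively oriented, then for every $C^1$ section $\xi$ of $f^*TM_2$, with components $\xi^\gamma$, one has on $x(U)$ $$\langle \operatorname{Cof}df,\nabla^{f^*TM_2}\xi\rangle_{\mathfrak g,\mathfrak h}\,|\mathfrak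 g|^{1/2}=\Big((\operatorname{cof}[df]^T)^j_\gamma\,\partial_j\xi^\gamma+(f^*\Gamma^\beta_{\beta\gamma})\det[df]\,\xi^\gamma\Big)|f^*\mathfrak h|^{1/2}.$$ 2. At every point of $x(U)$ and for every $\gamma$, the left-hand side of (A) equals $-\partial_j\big((\operatorname{cof}[df]^T)^j_\gamma\big)$. Hence (A) is equivalent to the identity $$\partial_j\big((\operatorname{cof}[df]^T)^j_\gamma\big)=0,\tag{B}$$ which involves neither metric. Identity (B) holds on $x(U)$ for all charts $x,y$ and all $\gamma$, and the Riemannian Piola identity holds on all of $M_1$. 3. The formula $\partial_j\big(|f^*\mathfrak h|^{1/2}(\operatorname{cof}[df]^T)^j_\gamma\big)=0$ of Marsden and Hughes, which lacks the connection term, is incorrect: at every point of $x(U)$ its left-hand side equals $|f^*\mathfrak h|^{1/2}(f^*\Gamma^\beta_{\beta\gamma})\det[df]$, so for given $\gamma$ it vanishes at a point if and only if $f^*\Gamma^\beta_{\beta\gamma}=0$ or $\det[df]=0$ there. It fails even in the Euclidean setting: for every $d\ge1$ there are smooth charts $x,y$ of Euclidean $\mathbb R^d$ such that for $f=\mathrm{id}_{\mathbb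 R^d}$ the formula is violated at some point of $x(U)$ for some $\gamma$. -/

import Mathlib

open Bundle
open scoped Manifold ContDiff Matrix

noncomputable section

namespace Piola

/-! ### Multilinear algebra: Hodge star and intrinsic cofactor -/

section LinearAlgebra

variable {V W : Type*} [NormedAddCommGroup V] [InnerProductSpace ℝ V] [FiniteDimensional ℝ V]
  [NormedAddCommGroup W] [InnerProductSpace ℝ W] [FiniteDimensional ℝ W]

/-- The wedge product with a fixed right factor, `a ↦ a ∧ b`, as a map `⋀ᵏ V → ⋀ᵈ V`, where
`b : ⋀ˡ V` and `k + l = d`. -/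
def wedgeRight {k l d : ℕ} (h : k + l = d) (b : ⋀[ℝ]^l V) : ⋀[ℝ]^k V →ₗ[ℝ] ⋀[ℝ]^d V where
  toFun a := ⟨(a : ExteriorAlgebra ℝ V) * (b : ExteriorAlgebra ℝ V), by
    subst h
    exact SetLike.GradedMul.mul_mem a.2 b.2⟩
  map_add' a a' := by
    ext
    simp [add_mul]
  map_smul' c a := by
    ext
    simp

/-- The unit volume form of an oriented inner product space, as a linear functional on the top
exterior power: it takes the value `1` on `e₁ ∧ ⋯ ∧ e_d` for every positively oriented orthonormal
basis `e`. -/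
def volTop {d : ℕ} [Fact (Module.finrank ℝ V = d)] (o : Orientation ℝ V (Fin d)) :
    ⋀[ℝ]^d V →ₗ[ℝ] ℝ :=
  exteriorPower.alternatingMapLinearEquiv o.volumeForm

/-- The Hodge star `⋆ : ⋀ᵏ V → ⋀ˡ V`, `k + l = d`, of an oriented `d`-dimensional inner product
space. It is the map with `⟪⋆a, b⟫ = Vol (a ∧ b)` for all `b : ⋀ˡ V`, written out in the
orthonormal basis `e_T = e_{t₁} ∧ ⋯ ∧ e_{t_l}` of `⋀ˡ V` given by an orthonormal basis `e` of `V`;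
so `⋆ (e₁ ∧ ⋯ ∧ e_k) = e_{k+1} ∧ ⋯ ∧ e_d` for positively oriented orthonormal `e`. -/
def hodge {d k l : ℕ} [Fact (Module.finrank ℝ V = d)] (o : Orientation ℝ V (Fin d))
    (h : k + l = d) : ⋀[ℝ]^k V →ₗ[ℝ] ⋀[ℝ]^l V :=
  let e := (stdOrthonormalBasis ℝ V).toBasis.exteriorPower l
  ∑ T, (volTop o ∘ₗ wedgeRight h (e T)).smulRight (e T)

/-- The intrinsic cofactor `Cof A = (-1)^(d-1) ⋆_W^(d-1) ∘ ⋀^(d-1) A ∘ ⋆_V^1` of a linear map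
between oriented `d`-dimensional inner product spaces, with `⋀¹ V ≃ V` and `⋀¹ W ≃ W`. -/
def Cof {d : ℕ} [NeZero d] [Fact (Module.finrank ℝ V = d)] [Fact (Module.finrank ℝ W = d)]
    (oV : Orientation ℝ V (Fin d)) (oW : Orientation ℝ W (Fin d)) (A : V →ₗ[ℝ] W) :
    V →ₗ[ℝ] W :=
  (-1 : ℝ) ^ (d - 1) •
    ((exteriorPower.oneEquiv ℝ W).toLinearMap ∘ₗ
      hodge oW (Nat.sub_add_cancel (NeZero.one_le : 1 ≤ d)) ∘ₗ
      exteriorPower.map (d - 1) A ∘ₗ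
      hodge oV (Nat.add_sub_cancel' (NeZero.one_le : 1 ≤ d)) ∘ₗ
      (exteriorPower.oneEquiv ℝ V).symm.toLinearMap)

/-- The inner product on `Hom(V, W) = V* ⊗ W` induced by those of `V` and `W`:
`⟪A, B⟫ = tr (Aᵀ B) = ∑ i, ⟪A eᵢ, B eᵢ⟫` for any orthonormal basis `e` of `V`. -/
def homInner (A B : V →ₗ[ℝ] W) : ℝ :=
  LinearMap.trace ℝ V (LinearMap.adjoint A ∘ₗ B)

/-- The cofactor of a matrix, the transpose of its adjugate. -/
def matCof {d : ℕ} (A : Matrix (Fin d) (Fin d) ℝ) : Matrix (Fin d) (Fin d) ℝ :=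
  A.adjugateᵀ

end LinearAlgebra

/-! ### Coordinates on a Riemannian manifold -/

/-- Coordinate space `ℝᵈ`. -/
abbrev Coord (d : ℕ) : Type := EuclideanSpace ℝ (Fin d)

/-- The `i`-th standard basis vector of `ℝᵈ`. -/
def stdVec {d : ℕ} (i : Fin d) : Coord d := EuclideanSpace.single i 1

/-- The partial derivative `∂ᵢ φ` of a function of `d` real variables. -/
def pd {d : ℕ} (i : Fin d) (φ : Coord d → ℝ) (u : Coord d) : ℝ := fderiv ℝ φ u (stdVec i)

section Manifold

variable {d : ℕ} {M : Type*} [TopologicalSpace M] [ChartedSpace (Coord d) M]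

instance (p : M) : FiniteDimensional ℝ (TangentSpace (𝓡 d) p) :=
  inferInstanceAs (FiniteDimensional ℝ (Coord d))

instance (p : M) : Fact (Module.finrank ℝ (TangentSpace (𝓡 d) p) = d) :=
  ⟨(finrank_euclideanSpace_fin : Module.finrank ℝ (Coord d) = d)⟩

/-- The coordinate components `v^α = dy^α(v)` of a tangent vector `v` at `q`. -/
def comp (y : OpenPartialHomeomorph M (Coord d)) (q : M) (α : Fin d) :
    TangentSpace (𝓡 d) q →ₗ[ℝ] ℝ :=
  (EuclideanSpace.proj (𝕜 := ℝ) α : Coord d →L[ℝ] ℝ).toLinearMap ∘ₗ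
    (mfderiv (𝓡 d) (𝓡 d) y q).toLinearMap

/-- The coordinate vector `∂_α` at the point `q` of the domain of the chart `y`, i.e. the tangent
vector that `dy` maps to the `α`-th standard basis vector. -/
def frame (y : OpenPartialHomeomorph M (Coord d)) (q : M) (α : Fin d) :
    TangentSpace (𝓡 d) q :=
  (mfderiv (𝓡 d) (𝓡 d) y q).inverse (stdVec α)

variable [RiemannianBundle (fun p : M => TangentSpace (𝓡 d) p)]

/-- The matrix `h_{αβ} = ⟪∂_α, ∂_β⟫` of the metric in the chart `y`, as a function of the
coordinates. -/
def gram (y : OpenPartialHomeomorph M (Coord d)) (v : Coord d) : Matrix (Fin d) (Fin d) ℝ :=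
  Matrix.of fun α β => inner ℝ (frame y (y.symm v) α) (frame y (y.symm v) β)

/-- The volume density `|h|^{1/2}` in the chart `y`. -/
def density (y : OpenPartialHomeomorph M (Coord d)) (v : Coord d) : ℝ :=
  √(gram y v).det

/-- The Christoffel symbols `Γ^α_{βγ}` of the Levi-Civita connection in the chart `y`:
`Γ^α_{βγ} = ½ h^{αδ} (∂_β h_{δγ} + ∂_γ h_{δβ} - ∂_δ h_{βγ})`. -/
def christoffel (y : OpenPartialHomeomorph M (Coord d)) (α β γ : Fin d) (v : Coord d) : ℝ :=
  (1 / 2) * ∑ δ, (gram y v)⁻¹ α δ *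
    (pd β (fun w => gram y w δ γ) v + pd γ (fun w => gram y w δ β) v
      - pd δ (fun w => gram y w β γ) v)

/-- The measure `|g|^{1/2} dx` on the domain of the chart `x`. -/
def chartVolume [MeasurableSpace M] (x : OpenPartialHomeomorph M (Coord d)) :
    MeasureTheory.Measure M :=
  (((MeasureTheory.volume : MeasureTheory.Measure (Coord d)).restrict x.target).withDensity
    fun u => ENNReal.ofReal (density x u)).map x.symm

variable (d M) in
/-- The Riemannian volume measure `dVol`: the smallest measure that dominates `|g|^{1/2} dx` on the
domain of every chart (on each such domain it coincides with it, since these measures agree on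
overlaps). -/
def riemVolume [MeasurableSpace M] : MeasureTheory.Measure M :=
  ⨆ x ∈ IsManifold.maximalAtlas (𝓡 d) ∞ M, chartVolume x

/-- The chart `x` is positively oriented for the family `o` of orientations of the tangent spaces:
the coordinate frame is positively oriented at each point of the domain. -/
def IsPositiveChart (o : ∀ p : M, Orientation ℝ (TangentSpace (𝓡 d) p) (Fin d))
    (x : OpenPartialHomeomorph M (Coord d)) : Prop :=
  ∀ p ∈ x.source, 0 < (o p).volumeForm (frame x p)

variable (d M) in
/-- An orientation of a manifold: orientations of the tangent spaces, such that there is a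
positively oriented smooth chart around each point. -/
structure ManifoldOrientation where
  /-- the orientation of the tangent space at `p` -/
  orient : ∀ p : M, Orientation ℝ (TangentSpace (𝓡 d) p) (Fin d)
  exists_positive : ∀ p : M, ∃ x ∈ IsManifold.maximalAtlas (𝓡 d) ∞ M,
    p ∈ x.source ∧ IsPositiveChart orient x

end Manifold

/-! ### The Riemannian Piola identity -/

section Maps

variable {d : ℕ} {M₁ M₂ : Type*}
  [TopologicalSpace M₁] [ChartedSpace (Coord d) M₁]
  [TopologicalSpace M₂] [ChartedSpace (Coord d) M₂]
  [RiemannianBundle (fun p : M₂ => TangentSpace (𝓡 d) p)]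

/-- The covariant derivative `∇^{f^*TM₂} ξ` at `p` of a vector field `ξ` along `f`, computed in
the chart `y` of `M₂` around `f p`: its `β`-component is `dξ^β + Γ^β_{γδ}(f) df^γ ξ^δ`. -/
def covDerivIn (y : OpenPartialHomeomorph M₂ (Coord d)) (f : M₁ → M₂)
    (ξ : ∀ p, TangentSpace (𝓡 d) (f p)) (p : M₁) :
    TangentSpace (𝓡 d) p →ₗ[ℝ] TangentSpace (𝓡 d) (f p) :=
  ∑ β, ((mvfderiv (𝓡 d) (fun q => comp y (f q) β (ξ q)) p).toLinearMap +
    ∑ γ, ∑ δ, (christoffel y β γ δ (y (f p)) * comp y (f p) δ (ξ p)) •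
      (comp y (f p) γ ∘ₗ (mfderiv (𝓡 d) (𝓡 d) f p).toLinearMap)).smulRight (frame y (f p) β)

/-- The covariant derivative `∇^{f^*TM₂} ξ` induced by the Levi-Civita connection of `M₂` on vector
fields along `f` (the value does not depend on the chart of `M₂` around `f p`). -/
def covDeriv (f : M₁ → M₂) (ξ : ∀ p, TangentSpace (𝓡 d) (f p)) (p : M₁) :
    TangentSpace (𝓡 d) p →ₗ[ℝ] TangentSpace (𝓡 d) (f p) :=
  covDerivIn (chartAt (Coord d) (f p)) f ξ p

/-- `ξ` is a `C¹` section of `f^*TM₂`. -/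
def IsC1Along [IsManifold (𝓡 d) ∞ M₂] (f : M₁ → M₂) (ξ : ∀ p, TangentSpace (𝓡 d) (f p)) : Prop :=
  ContMDiff (𝓡 d) (𝓡 d).tangent 1 (fun p => (⟨f p, ξ p⟩ : TangentBundle (𝓡 d) M₂))

variable [RiemannianBundle (fun p : M₁ => TangentSpace (𝓡 d) p)]

/-- `Cof df`, a one-form on `M₁` with values in `f^*TM₂`. -/
def cofDiff [NeZero d] (o₁ : ManifoldOrientation d M₁) (o₂ : ManifoldOrientation d M₂)
    (f : M₁ → M₂) (p : M₁) : TangentSpace (𝓡 d) p →ₗ[ℝ] TangentSpace (𝓡 d) (f p) :=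
  Cof (o₁.orient p) (o₂.orient (f p)) (mfderiv (𝓡 d) (𝓡 d) f p).toLinearMap

/-- `η = δ_{∇^{f^*TM₂}} ρ` on the open set `U`: the section `η` is the image of the
`f^*TM₂`-valued one-form `ρ` under the formal adjoint of `∇^{f^*TM₂}`, i.e.
`∫ ⟪σ, η⟫ dVol = ∫ ⟪∇σ, ρ⟫ dVol` for all sections `σ` with compact support in `U`. -/
def IsCoderivativeOn [IsManifold (𝓡 d) ∞ M₂] [MeasurableSpace M₁] (f : M₁ → M₂) (U : Set M₁)
    (ρ : ∀ p, TangentSpace (𝓡 d) p →ₗ[ℝ] TangentSpace (𝓡 d) (f p))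
    (η : ∀ p, TangentSpace (𝓡 d) (f p)) : Prop :=
  ∀ σ : ∀ p, TangentSpace (𝓡 d) (f p), IsC1Along f σ →
    IsCompact (closure {p | σ p ≠ 0}) → closure {p | σ p ≠ 0} ⊆ U →
    ∫ p, inner ℝ (σ p) (η p) ∂(riemVolume d M₁) =
      ∫ p, homInner (covDeriv f σ p) (ρ p) ∂(riemVolume d M₁)

/-- The Riemannian Piola identity `δ_{∇^{f^*TM₂}} Cof df = 0` on the open set `U`. -/
def RiemannianPiolaOn [NeZero d] [IsManifold (𝓡 d) ∞ M₂] [MeasurableSpace M₁]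
    (o₁ : ManifoldOrientation d M₁) (o₂ : ManifoldOrientation d M₂)
    (f : M₁ → M₂) (U : Set M₁) : Prop :=
  IsCoderivativeOn f U (cofDiff o₁ o₂ f) (fun _ => 0)

end Maps

/-! ### Coordinate expressions -/

section Coordinates

variable {d : ℕ} {M₁ M₂ : Type*}
  [TopologicalSpace M₁] [ChartedSpace (Coord d) M₁]
  [TopologicalSpace M₂] [ChartedSpace (Coord d) M₂]

/-- The coordinate representation of `f` in the charts `x` and `y`. -/
def coordRep (f : M₁ → M₂) (x : OpenPartialHomeomorph M₁ (Coord d))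
    (y : OpenPartialHomeomorph M₂ (Coord d)) (u : Coord d) : Coord d :=
  y (f (x.symm u))

/-- The set of coordinates in which the representation of `f` in the charts `x`, `y` is defined. -/
def coordDomain (f : M₁ → M₂) (x : OpenPartialHomeomorph M₁ (Coord d))
    (y : OpenPartialHomeomorph M₂ (Coord d)) : Set (Coord d) :=
  {u | u ∈ x.target ∧ f (x.symm u) ∈ y.source}

/-- The matrix `[df]` with entries `∂ᵢ f^α` (row `α`, column `i`). -/
def jac (f : M₁ → M₂) (x : OpenPartialHomeomorph M₁ (Coord d))
    (y : OpenPartialHomeomorph M₂ (Coord d)) (u : Coord d) : Matrix (Fin d) (Fin d) ℝ :=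
  Matrix.of fun α i => pd i (fun w => coordRep f x y w α) u

/-- The expression `∂_j ((cof [df]ᵀ)^j_γ)`. -/
def divCof (f : M₁ → M₂) (x : OpenPartialHomeomorph M₁ (Coord d))
    (y : OpenPartialHomeomorph M₂ (Coord d)) (γ : Fin d) (u : Coord d) : ℝ :=
  ∑ j, pd j (fun w => (matCof (jac f x y w))ᵀ j γ) u

variable [RiemannianBundle (fun p : M₂ => TangentSpace (𝓡 d) p)]

/-- The function `|f^*h|^{1/2}`, i.e. `|h|^{1/2}` composed with the representation of `f`. -/
def pullDensity (f : M₁ → M₂) (x : OpenPartialHomeomorph M₁ (Coord d))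
    (y : OpenPartialHomeomorph M₂ (Coord d)) (u : Coord d) : ℝ :=
  density y (coordRep f x y u)

/-- The function `f^*Γ^β_{βγ}` (summed over `β`). -/
def pullTraceChristoffel (f : M₁ → M₂) (x : OpenPartialHomeomorph M₁ (Coord d))
    (y : OpenPartialHomeomorph M₂ (Coord d)) (γ : Fin d) (u : Coord d) : ℝ :=
  ∑ β, christoffel y β β γ (coordRep f x y u)

/-- The expression `∂_j (|f^*h|^{1/2} (cof [df]ᵀ)^j_γ)`. -/
def divDensityCof (f : M₁ → M₂) (x : OpenPartialHomeomorph M₁ (Coord d))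
    (y : OpenPartialHomeomorph M₂ (Coord d)) (γ : Fin d) (u : Coord d) : ℝ :=
  ∑ j, pd j (fun w => (matCof (jac f x y w))ᵀ j γ * pullDensity f x y w) u

/-- The expression
`- |f^*h|^{-1/2} ∂_j ((cof [df]ᵀ)^j_γ |f^*h|^{1/2}) + (f^*Γ^β_{βγ}) det [df]`. -/
def coordPiola (f : M₁ → M₂) (x : OpenPartialHomeomorph M₁ (Coord d))
    (y : OpenPartialHomeomorph M₂ (Coord d)) (γ : Fin d) (u : Coord d) : ℝ :=
  -(1 / pullDensity f x y u) * divDensityCof f x y γ u +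
    pullTraceChristoffel f x y γ u * (jac f x y u).det

end Coordinates

end Piola

end

open Piola

/-!
The identity `∂_γ |h|^{1/2} = |h|^{1/2} Γ^β_{βγ}`, the chain rule and `[df] adj [df] = det [df] • 1`
make the derivative of the density in (A) cancel exactly against the connection term, so that the
left-hand side of (A) is `-∂_j ((cof [df]ᵀ)^j_γ)`. This vanishes because the derivative of a
cofactor, expanded along rows, pairs symmetric second derivatives with alternating minors. In
positive charts `⟨Cof df, ∇ξ⟩ |g|^{1/2}` is `|f^*h|^{1/2} tr (adj [df] [∇ξ])`, hence the
coordinate divergence of the flux `(cof [df]ᵀ)^j_γ |f^*h|^{1/2} ξ^γ`, whose integral is zero when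
`ξ` has compact support in the charts; a partition of unity globalises this statement. In the
Euclidean counterexample both charts have inverse `(sinh v₀, v₁, …)`, so that the density is
`cosh v₀` and the expression of Marsden and Hughes for the identity map is `sinh v₀`.
-/

noncomputable section

namespace Piola

section Algebra

open Module (Basis)

variable {R : Type*} [CommRing R]

section Matrix

variable {n : Type*} [Fintype n] [DecidableEq n]

theorem sum_det_updateCol (M N : Matrix n n R) :
    ∑ i, (M.updateCol i fun k => N k i).det = (M.adjugate * N).trace := by
  refine Finset.sum_congr rfl fun i _ => ?_
  rw [← Matrix.cramer_apply, Matrix.cramer_eq_adjugate_mulVec]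
  rfl

theorem trace_adjugate_mul_mul (M N P : Matrix n n R) :
    ((M * P).adjugate * (N * P)).trace = P.det * (M.adjugate * N).trace :=
  calc ((M * P).adjugate * (N * P)).trace
    _ = (P.adjugate * (M.adjugate * N * P)).trace := by
      simp only [Matrix.adjugate_mul_distrib, Matrix.mul_assoc]
    _ = (M.adjugate * N * (P * P.adjugate)).trace := by
      rw [Matrix.trace_mul_comm, Matrix.mul_assoc]
    _ = P.det * (M.adjugate * N).trace := by simp [Matrix.mul_adjugate]

theorem sum_map_update_basis {V W : Type*} [AddCommGroup V] [Module R V] [AddCommGroup W]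
    [Module R W] (φ : W [⋀^n]→ₗ[R] R) (bV : Basis n R V) (bW : Basis n R W) (A B : V →ₗ[R] W) :
    ∑ i, φ (Function.update (A ∘ bV) i (B (bV i))) =
      φ bW * ((LinearMap.toMatrix bV bW A).adjugate * LinearMap.toMatrix bV bW B).trace := by
  rw [← sum_det_updateCol, Finset.mul_sum]
  refine Finset.sum_congr rfl fun i _ => ?_
  conv_lhs => rw [φ.eq_smul_basis_det bW]
  rw [AlternatingMap.smul_apply, smul_eq_mul, Basis.det_apply]
  congr 2
  ext k j
  obtain rfl | hj := eq_or_ne j i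
  · simp [Basis.toMatrix_apply, LinearMap.toMatrix_apply]
  · simp [Basis.toMatrix_apply, LinearMap.toMatrix_apply, hj]

end Matrix

section ExteriorPower

variable {V : Type*} [AddCommGroup V] [Module R V]

theorem sum_exteriorPower_basis_one {ι E : Type*} [LinearOrder ι] [Fintype ι] [AddCommMonoid E]
    (b : Basis ι R V) (G : ⋀[R]^1 V → E) :
    ∑ T, G (b.exteriorPower 1 T) = ∑ i, G (exteriorPower.ιMulti R 1 fun _ => b i) := by
  rw [← (Set.powersetCard.ofSingleton (α := ι)).sum_comp]
  refine Finset.sum_congr rfl fun i _ => ?_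
  rw [exteriorPower.basis_apply, exteriorPower.ιMulti_family]
  congr 2
  funext j
  have hmem : Set.powersetCard.ofFinEmbEquiv.symm (Set.powersetCard.ofSingleton i) j ∈
      Set.range (Set.powersetCard.ofFinEmbEquiv.symm (Set.powersetCard.ofSingleton i)) := ⟨j, rfl⟩
  rw [Set.powersetCard.mem_range_ofFinEmbEquiv_symm_iff_mem] at hmem
  have heq : Set.powersetCard.ofFinEmbEquiv.symm (Set.powersetCard.ofSingleton i) j = i := by
    simpa [Set.powersetCard.ofSingleton, ← Set.powersetCard.mem_coe_iff] using hmem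
  simp [heq]

theorem sum_exteriorPower_basis_succAbove {E : Type*} [AddCommMonoid E] {n : ℕ}
    (b : Basis (Fin (n + 1)) R V) (G : ⋀[R]^n V → E) :
    ∑ T, G (b.exteriorPower n T) =
      ∑ i : Fin (n + 1), G (exteriorPower.ιMulti R n (b ∘ i.succAbove)) := by
  rw [← ((Set.powersetCard.ofSingleton (α := Fin (n + 1))).trans
    (Set.powersetCard.compl (m := n) (by simp))).sum_comp]
  refine Finset.sum_congr rfl fun i _ => ?_
  rw [exteriorPower.basis_apply, exteriorPower.ιMulti_family]
  congr 3
  rw [Set.powersetCard.ofFinEmbEquiv_symm_apply]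
  exact congrArg DFunLike.coe (Finset.orderEmbOfFin_compl_singleton_eq_succAboveOrderEmb i)

theorem map_vecCons_succAbove {n : ℕ} {N : Type*} [AddCommGroup N] [Module R N]
    (φ : V [⋀^Fin (n + 1)]→ₗ[R] N) (i : Fin (n + 1)) (v : Fin (n + 1) → V) (x : V) :
    φ (Matrix.vecCons x (v ∘ i.succAbove)) = (-1) ^ (i : ℕ) • φ (Function.update v i x) := by
  have hins : Fin.insertNth i x (v ∘ i.succAbove) = Function.update v i x :=
    Fin.insertNth_removeNth (α := fun _ => V) i x v
  rw [← φ.neg_one_pow_smul_map_insertNth i, hins]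

theorem map_snoc_succAbove {n : ℕ} {N : Type*} [AddCommGroup N] [Module R N]
    (φ : V [⋀^Fin (n + 1)]→ₗ[R] N) (i : Fin (n + 1)) (v : Fin (n + 1) → V) (x : V) :
    φ (Fin.snoc (v ∘ i.succAbove) x) =
      (-1) ^ n • (-1) ^ (i : ℕ) • φ (Function.update v i x) := by
  rw [← map_vecCons_succAbove, ← Fin.insertNth_last', φ.map_insertNth, Fin.val_last]

end ExteriorPower

end Algebra

section HodgeStar

variable {V : Type*} [NormedAddCommGroup V] [InnerProductSpace ℝ V]

theorem wedgeRight_ιMulti {k l d : ℕ} (h : k + l = d) (a : Fin k → V) (b : Fin l → V) :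
    wedgeRight h (exteriorPower.ιMulti ℝ l b) (exteriorPower.ιMulti ℝ k a) =
      exteriorPower.ιMulti ℝ d (Fin.append a b ∘ Fin.cast h.symm) := by
  subst h
  ext
  simp [wedgeRight, ExteriorAlgebra.ιMulti_mul_ιMulti]

theorem volTop_wedgeRight_ιMulti {k l d : ℕ} [Fact (Module.finrank ℝ V = d)]
    (o : Orientation ℝ V (Fin d)) (h : k + l = d) (a : Fin k → V) (b : Fin l → V) :
    volTop o (wedgeRight h (exteriorPower.ιMulti ℝ l b) (exteriorPower.ιMulti ℝ k a)) =
      o.volumeForm (Fin.append a b ∘ Fin.cast h.symm) := by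
  rw [wedgeRight_ιMulti, volTop, exteriorPower.alternatingMapLinearEquiv_apply_ιMulti]

theorem volTop_wedgeRight_succAbove {n : ℕ} [Fact (Module.finrank ℝ V = n + 1)]
    (o : Orientation ℝ V (Fin (n + 1))) (h : 1 + n = n + 1) (v : Fin (n + 1) → V)
    (i j : Fin (n + 1)) :
    volTop o (wedgeRight h (exteriorPower.ιMulti ℝ n (v ∘ j.succAbove))
        ((exteriorPower.oneEquiv ℝ V).symm (v i))) =
      if j = i then (-1) ^ (i : ℕ) * o.volumeForm v else 0 := by
  have hcons : (Fin.append (fun _ => v i) (v ∘ j.succAbove)) ∘ Fin.cast h.symm =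
      Matrix.vecCons (v i) (v ∘ j.succAbove) := by
    rw [Matrix.vecCons, Fin.append_left_eq_cons]
    rfl
  rw [exteriorPower.oneEquiv_symm_apply, volTop_wedgeRight_ιMulti, hcons, map_vecCons_succAbove]
  split_ifs with hji
  · subst hji
    simp [zsmul_eq_mul]
  · rw [o.volumeForm.map_eq_zero_of_eq _ (by simp [Function.update_of_ne (Ne.symm hji)]) hji,
      smul_zero]

variable [FiniteDimensional ℝ V]

variable (V) in
/-- The standard orthonormal basis, in terms of which `hodge` is defined, with the index set
`Fin (finrank ℝ V)` replaced by `Fin d`. -/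
def stdONB (d : ℕ) [h : Fact (Module.finrank ℝ V = d)] : OrthonormalBasis (Fin d) ℝ V :=
  (stdOrthonormalBasis ℝ V).reindex (finCongr h.out)

theorem hodge_apply {d k l : ℕ} [Fact (Module.finrank ℝ V = d)] (o : Orientation ℝ V (Fin d))
    (h : k + l = d) (a : ⋀[ℝ]^k V) :
    hodge o h a = ∑ T, volTop o (wedgeRight h ((stdONB V d).toBasis.exteriorPower l T) a) •
      (stdONB V d).toBasis.exteriorPower l T := by
  obtain rfl : Module.finrank ℝ V = d := Fact.out
  simp [hodge, stdONB]

theorem hodge_oneEquiv_symm {n : ℕ} [Fact (Module.finrank ℝ V = n + 1)]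
    (o : Orientation ℝ V (Fin (n + 1))) (h : 1 + n = n + 1) (i : Fin (n + 1)) :
    hodge o h ((exteriorPower.oneEquiv ℝ V).symm (stdONB V (n + 1) i)) =
      ((-1) ^ (i : ℕ) * o.volumeForm (stdONB V (n + 1))) •
        exteriorPower.ιMulti ℝ n (stdONB V (n + 1) ∘ i.succAbove) := by
  rw [hodge_apply, sum_exteriorPower_basis_succAbove (stdONB V (n + 1)).toBasis fun b =>
    volTop o (wedgeRight h b ((exteriorPower.oneEquiv ℝ V).symm (stdONB V (n + 1) i))) • b]
  simp only [OrthonormalBasis.coe_toBasis, volTop_wedgeRight_succAbove, ite_smul, zero_smul,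
    Finset.sum_ite_eq', Finset.mem_univ, if_true]

theorem inner_oneEquiv_hodge {n : ℕ} [Fact (Module.finrank ℝ V = n + 1)]
    (o : Orientation ℝ V (Fin (n + 1))) (h : n + 1 = n + 1) (a : Fin n → V) (w : V) :
    inner ℝ (exteriorPower.oneEquiv ℝ V (hodge o h (exteriorPower.ιMulti ℝ n a))) w =
      o.volumeForm (Fin.snoc a w) := by
  have hwedge (z : V) : volTop o (wedgeRight h (exteriorPower.ιMulti ℝ 1 fun _ => z)
      (exteriorPower.ιMulti ℝ n a)) = o.volumeForm (Fin.snoc a z) := by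
    rw [volTop_wedgeRight_ιMulti, Fin.append_right_eq_snoc]
    rfl
  set L := o.volumeForm.toMultilinearMap.toLinearMap
    (Fin.snoc a (0 : V) : Fin (n + 1) → V) (Fin.last n) with hL
  have hlin (z : V) : o.volumeForm (Fin.snoc a z) = L z := by
    rw [hL, MultilinearMap.toLinearMap_apply, Fin.update_snoc_last]
    rfl
  rw [hodge_apply, sum_exteriorPower_basis_one (stdONB V (n + 1)).toBasis
    fun b => volTop o (wedgeRight h b (exteriorPower.ιMulti ℝ n a)) • b]
  conv_rhs => rw [← (stdONB V (n + 1)).sum_repr w]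
  simp only [map_sum, map_smul, exteriorPower.oneEquiv_ιMulti, hwedge, hlin, sum_inner,
    real_inner_smul_left, OrthonormalBasis.coe_toBasis, smul_eq_mul,
    OrthonormalBasis.repr_apply_apply, mul_comm]

theorem volumeForm_stdONB_mul_self {d : ℕ} [Fact (Module.finrank ℝ V = d)]
    (o : Orientation ℝ V (Fin d)) : o.volumeForm (stdONB V d) * o.volumeForm (stdONB V d) = 1 := by
  rw [← abs_mul_abs_self, o.abs_volumeForm_apply_of_orthonormal, one_mul]

theorem volumeForm_sq {d : ℕ} [Fact (Module.finrank ℝ V = d)] (o : Orientation ℝ V (Fin d))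
    (v : Fin d → V) : o.volumeForm v ^ 2 = (Matrix.gram ℝ v).det := by
  have hgram := Matrix.gram_eq_conjTranspose_mul (stdONB V d) v
  rw [hgram, Matrix.det_mul, Matrix.conjTranspose_eq_transpose_of_trivial, Matrix.det_transpose,
    ← sq, ← sq_abs, o.volumeForm_robust' (stdONB V d), sq_abs,
    Module.Basis.det_apply]
  rfl

end HodgeStar

section Cofactor

variable {V W : Type*} [NormedAddCommGroup V] [InnerProductSpace ℝ V] [FiniteDimensional ℝ V]
  [NormedAddCommGroup W] [InnerProductSpace ℝ W] [FiniteDimensional ℝ W]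

theorem homInner_eq_sum {ι : Type*} [Fintype ι] (e : OrthonormalBasis ι ℝ V) (A B : V →ₗ[ℝ] W) :
    homInner A B = ∑ i, inner ℝ (A (e i)) (B (e i)) := by
  rw [homInner, LinearMap.trace_eq_sum_inner _ e]
  simp only [LinearMap.comp_apply, LinearMap.adjoint_inner_right]

theorem homInner_comm (A B : V →ₗ[ℝ] W) : homInner A B = homInner B A := by
  simp only [homInner_eq_sum (stdOrthonormalBasis ℝ V), real_inner_comm]

theorem homInner_zero_left (B : V →ₗ[ℝ] W) : homInner 0 B = 0 := by
  rw [homInner, map_zero, LinearMap.zero_comp, map_zero]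

theorem homInner_sum_left {ι : Type*} (s : Finset ι) (A : ι → V →ₗ[ℝ] W) (B : V →ₗ[ℝ] W) :
    homInner (∑ i ∈ s, A i) B = ∑ i ∈ s, homInner (A i) B := by
  simp only [homInner_eq_sum (stdOrthonormalBasis ℝ V), LinearMap.sum_apply, sum_inner]
  exact Finset.sum_comm

theorem inner_Cof_stdONB {d : ℕ} [NeZero d] [Fact (Module.finrank ℝ V = d)]
    [Fact (Module.finrank ℝ W = d)] (oV : Orientation ℝ V (Fin d)) (oW : Orientation ℝ W (Fin d))
    (A : V →ₗ[ℝ] W) (i : Fin d) (w : W) :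
    inner ℝ (Cof oV oW A (stdONB V d i)) w =
      oV.volumeForm (stdONB V d) * oW.volumeForm (Function.update (A ∘ stdONB V d) i w) := by
  obtain ⟨n, rfl⟩ : ∃ n, d = n + 1 := ⟨d - 1, (Nat.sub_add_cancel NeZero.one_le).symm⟩
  have hCof : Cof oV oW A (stdONB V (n + 1) i) = (-1 : ℝ) ^ n •
      exteriorPower.oneEquiv ℝ W (hodge oW rfl (exteriorPower.map n A
        (hodge oV (add_comm 1 n) ((exteriorPower.oneEquiv ℝ V).symm (stdONB V (n + 1) i))))) :=
    rfl
  rw [hCof, hodge_oneEquiv_symm, map_smul, map_smul, map_smul, exteriorPower.map_apply_ιMulti,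
    real_inner_smul_left, real_inner_smul_left, inner_oneEquiv_hodge, ← Function.comp_assoc,
    map_snoc_succAbove]
  have hsign (k : ℕ) : (-1 : ℝ) ^ k * (-1) ^ k = 1 := by rw [← mul_pow]; simp
  simp only [zsmul_eq_mul, Int.cast_pow, Int.cast_neg, Int.cast_one]
  linear_combination (oV.volumeForm (stdONB V (n + 1)) *
    oW.volumeForm (Function.update (A ∘ stdONB V (n + 1)) i w)) *
    ((-1 : ℝ) ^ (i : ℕ) * (-1) ^ (i : ℕ) * hsign n + hsign i)

theorem homInner_Cof_mul_volumeForm {d : ℕ} [NeZero d] [Fact (Module.finrank ℝ V = d)]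
    [Fact (Module.finrank ℝ W = d)] (oV : Orientation ℝ V (Fin d)) (oW : Orientation ℝ W (Fin d))
    (bV : Module.Basis (Fin d) ℝ V) (bW : Module.Basis (Fin d) ℝ W) (A B : V →ₗ[ℝ] W) :
    homInner (Cof oV oW A) B * oV.volumeForm bV =
      ((LinearMap.toMatrix bV bW A).adjugate * LinearMap.toMatrix bV bW B).trace *
        oW.volumeForm bW := by
  set e := (stdONB V d).toBasis
  set M := LinearMap.toMatrix e bW A with hM
  set N := LinearMap.toMatrix e bW B with hN
  set P := e.toMatrix bV
  have hhom : homInner (Cof oV oW A) B =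
      oV.volumeForm e * (oW.volumeForm bW * (M.adjugate * N).trace) := by
    simp only [homInner_eq_sum (stdONB V d), inner_Cof_stdONB, ← Finset.mul_sum]
    rw [hM, hN, ← sum_map_update_basis, OrthonormalBasis.coe_toBasis]
  have hvol : oV.volumeForm bV = oV.volumeForm e * P.det := by
    conv_lhs => rw [oV.volumeForm.eq_smul_basis_det e]
    rw [AlternatingMap.smul_apply, smul_eq_mul, Module.Basis.det_apply]
  have hA : LinearMap.toMatrix bV bW A = M * P :=
    (linearMap_toMatrix_mul_basis_toMatrix bV e bW A).symm
  have hB : LinearMap.toMatrix bV bW B = N * P :=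
    (linearMap_toMatrix_mul_basis_toMatrix bV e bW B).symm
  have hunit : oV.volumeForm e * oV.volumeForm e = 1 := by
    rw [OrthonormalBasis.coe_toBasis, volumeForm_stdONB_mul_self]
  rw [hhom, hvol, hA, hB, trace_adjugate_mul_mul]
  linear_combination (oW.volumeForm bW * (M.adjugate * N).trace * P.det) * hunit

end Cofactor

section Calculus

section RowExpansion

variable {R n : Type*} [CommRing R] [Fintype n]

theorem sum_sum_mul_eq_zero_of_symm_of_antisymm [IsAddTorsionFree R] {s t : n → n → R}
    (hs : ∀ i j, s i j = s j i) (ht : ∀ i j, t i j = -t j i) : ∑ i, ∑ j, s i j * t i j = 0 := by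
  refine self_eq_neg.1 ?_
  conv_lhs => rw [Finset.sum_comm]
  simp_rw [← Finset.sum_neg_distrib]
  refine Finset.sum_congr rfl fun i _ => Finset.sum_congr rfl fun j _ => ?_
  rw [hs, ht, mul_neg]

variable [DecidableEq n]

theorem det_updateRow_eq_sum_mul_adjugate (M : Matrix n n R) (α : n) (r : n → R) :
    (M.updateRow α r).det = ∑ i, r i * M.adjugate i α := by
  rw [Matrix.det_eq_sum_mul_adjugate_row _ α]
  simp [Matrix.adjugate_apply]

theorem sum_det_updateRow (M N : Matrix n n R) :
    ∑ α, (M.updateRow α (N α)).det = (M.adjugate * N).trace := by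
  simp_rw [det_updateRow_eq_sum_mul_adjugate, Matrix.trace, Matrix.diag_apply, Matrix.mul_apply]
  rw [Finset.sum_comm]
  simp_rw [mul_comm]

theorem adjugate_updateRow_single_swap (M : Matrix n n R) {α γ : n} (h : α ≠ γ) (i j : n) :
    (M.updateRow γ (Pi.single j 1)).adjugate i α =
      -(M.updateRow γ (Pi.single i 1)).adjugate j α := by
  have hswap : (M.updateRow γ (Pi.single j 1)).updateRow α (Pi.single i 1) =
      ((M.updateRow γ (Pi.single i 1)).updateRow α (Pi.single j 1)).submatrix
        (Equiv.swap α γ) id := by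
    ext k l
    simp only [Matrix.submatrix_apply, id, Matrix.updateRow_apply, Equiv.swap_apply_def]
    grind
  rw [Matrix.adjugate_apply, Matrix.adjugate_apply, hswap, Matrix.det_permute,
    Equiv.Perm.sign_swap h]
  simp

end RowExpansion

section Determinant

variable {𝕜 n E : Type*} [NontriviallyNormedField 𝕜] [DecidableEq n] [NormedAddCommGroup E]
  [NormedSpace 𝕜 E] {A : E → Matrix n n 𝕜} {u : E}

theorem differentiableAt_updateRow_single
    (hA : ∀ i j, DifferentiableAt 𝕜 (fun w => A w i j) u) (j γ : n) (α i : n) :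
    DifferentiableAt 𝕜 (fun w => (A w).updateRow γ (Pi.single j 1) α i) u := by
  obtain rfl | h := eq_or_ne α γ
  · simp
  · simpa [Matrix.updateRow_ne h] using hA α i

variable [Fintype n]

variable (𝕜 n) in
/-- The determinant as a continuous multilinear function of the rows, which makes the calculus of
multilinear maps available without the choice of a norm on matrices. -/
def detRow : ContinuousMultilinearMap 𝕜 (fun _ : n => n → 𝕜) 𝕜 where
  toMultilinearMap := Matrix.detRowAlternating.toMultilinearMap
  cont := Continuous.matrix_det (A := fun M : Matrix n n 𝕜 => M) continuous_id

theorem hasFDerivAt_det (hA : ∀ i j, DifferentiableAt 𝕜 (fun w => A w i j) u) :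
    HasFDerivAt (fun w => (A w).det)
      (∑ i, ((detRow 𝕜 n).toContinuousLinearMap (A u) i).comp
        (ContinuousLinearMap.pi fun j => fderiv 𝕜 (fun w => A w i j) u)) u :=
  HasFDerivAt.multilinear_comp (detRow 𝕜 n) fun i =>
    hasFDerivAt_pi.2 fun j => (hA i j).hasFDerivAt

theorem fderiv_det (hA : ∀ i j, DifferentiableAt 𝕜 (fun w => A w i j) u) (v : E) :
    fderiv 𝕜 (fun w => (A w).det) u v =
      ((A u).adjugate * Matrix.of fun i j => fderiv 𝕜 (fun w => A w i j) u v).trace := by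
  rw [(hasFDerivAt_det hA).fderiv, ← sum_det_updateRow, sum_apply]
  rfl

theorem fderiv_adjugate_apply (hA : ∀ i j, DifferentiableAt 𝕜 (fun w => A w i j) u) (j γ : n)
    (v : E) :
    fderiv 𝕜 (fun w => (A w).adjugate j γ) u v =
      ∑ α, if α = γ then 0 else ∑ i, fderiv 𝕜 (fun w => A w α i) u v *
        ((A u).updateRow γ (Pi.single j 1)).adjugate i α := by
  simp_rw [Matrix.adjugate_apply (A _) j γ]
  rw [fderiv_det (differentiableAt_updateRow_single hA j γ), ← sum_det_updateRow]
  refine Finset.sum_congr rfl fun α _ => ?_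
  rw [det_updateRow_eq_sum_mul_adjugate]
  split_ifs with h
  · subst h
    simp
  · simp [Matrix.updateRow_ne h]

theorem contDiffAt_det {k : WithTop ℕ∞} (hA : ∀ i j, ContDiffAt 𝕜 k (fun w => A w i j) u) :
    ContDiffAt 𝕜 k (fun w => (A w).det) u := by
  simp_rw [Matrix.det_apply']
  exact ContDiffAt.sum fun σ _ => contDiffAt_const.mul (contDiffAt_prod fun i _ => hA _ _)

theorem contDiffAt_adjugate {k : WithTop ℕ∞} (hA : ∀ i j, ContDiffAt 𝕜 k (fun w => A w i j) u)
    (j γ : n) : ContDiffAt 𝕜 k (fun w => (A w).adjugate j γ) u := by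
  simp_rw [Matrix.adjugate_apply]
  refine contDiffAt_det fun α i => ?_
  obtain rfl | h := eq_or_ne α γ
  · simpa using contDiffAt_const
  · simpa [Matrix.updateRow_ne h] using hA α i

end Determinant

theorem fderiv_sqrt_det {n E : Type*} [Fintype n] [DecidableEq n] [NormedAddCommGroup E]
    [NormedSpace ℝ E] {A : E → Matrix n n ℝ} {u : E}
    (hA : ∀ i j, DifferentiableAt ℝ (fun w => A w i j) u) (hdet : 0 < (A u).det) (v : E) :
    fderiv ℝ (fun w => √(A w).det) u v = √(A u).det *
      ((1 / 2) * ((A u)⁻¹ * Matrix.of fun i j => fderiv ℝ (fun w => A w i j) u v).trace) := by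
  rw [fderiv_sqrt (hasFDerivAt_det hA).differentiableAt hdet.ne', smul_apply,
    fderiv_det hA, Matrix.inv_def, Ring.inverse_eq_inv', Matrix.smul_mul, Matrix.trace_smul,
    smul_eq_mul, smul_eq_mul]
  have hsqrt : √(A u).det ≠ 0 := (Real.sqrt_pos.2 hdet).ne'
  field_simp
  rw [Real.sq_sqrt hdet.le, mul_comm]

section Jacobian

variable {d : ℕ} {F : Coord d → Coord d} {u : Coord d}

/-- The matrix of partial derivatives of a self-map of coordinate space: row `α` belongs to the
component `F^α`, column `i` to the variable `i`, as in `jac`. -/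
def jacobian (F : Coord d → Coord d) (u : Coord d) : Matrix (Fin d) (Fin d) ℝ :=
  Matrix.of fun α i => pd i (fun w => F w α) u

theorem contDiffAt_jacobian {m n : WithTop ℕ∞} (hF : ContDiffAt ℝ n F u) (hmn : m + 1 ≤ n)
    (α i : Fin d) : ContDiffAt ℝ m (fun w => jacobian F w α i) u :=
  ((contDiffAt_euclidean.1 hF α).fderiv_right hmn).clm_apply contDiffAt_const

theorem differentiableAt_jacobian (hF : ContDiffAt ℝ 2 F u) (α i : Fin d) :
    DifferentiableAt ℝ (fun w => jacobian F w α i) u :=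
  (contDiffAt_jacobian (m := 1) hF (by norm_num) α i).differentiableAt one_ne_zero

theorem pd_jacobian_comm (hF : ContDiffAt ℝ 2 F u) (α i j : Fin d) :
    pd j (fun w => jacobian F w α i) u = pd i (fun w => jacobian F w α j) u := by
  have hFα := contDiffAt_euclidean.1 hF α
  have hd : DifferentiableAt ℝ (fderiv ℝ fun w => F w α) u :=
    (hFα.fderiv_right (m := 1) (by norm_num)).differentiableAt one_ne_zero
  have hpd (k l : Fin d) : pd k (fun w => jacobian F w α l) u =
      fderiv ℝ (fderiv ℝ fun w => F w α) u (stdVec k) (stdVec l) := by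
    simp only [pd, jacobian, Matrix.of_apply]
    rw [fderiv_clm_apply hd (by fun_prop)]
    simp
  rw [hpd, hpd, (hFα.isSymmSndFDerivAt (by simp)).eq]

theorem sum_pd_adjugate_jacobian (hF : ContDiffAt ℝ 2 F u) (γ : Fin d) :
    ∑ j, pd j (fun w => (jacobian F w).adjugate j γ) u = 0 := by
  simp_rw [pd, fderiv_adjugate_apply (differentiableAt_jacobian hF)]
  rw [Finset.sum_comm]
  refine Finset.sum_eq_zero fun α _ => ?_
  obtain rfl | hαγ := eq_or_ne α γ
  · simp
  simp only [hαγ, if_false]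
  exact sum_sum_mul_eq_zero_of_symm_of_antisymm (fun j i => pd_jacobian_comm hF α i j)
    fun j i => adjugate_updateRow_single_swap _ hαγ i j

end Jacobian

end Calculus

section CoordinateSpace

variable {E : Type*} [NormedAddCommGroup E] [NormedSpace ℝ E] {d : ℕ}

-- Shortcuts: instance search exceeds its heartbeat limit on spaces of bilinear and trilinear forms.
instance : NormedAddCommGroup (E →L[ℝ] ℝ) := ContinuousLinearMap.toNormedAddCommGroup

instance : NormedSpace ℝ (E →L[ℝ] ℝ) := ContinuousLinearMap.toNormedSpace

instance : NormedAddCommGroup (E →L[ℝ] E →L[ℝ] ℝ) := ContinuousLinearMap.toNormedAddCommGroup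

instance : NormedSpace ℝ (E →L[ℝ] E →L[ℝ] ℝ) := ContinuousLinearMap.toNormedSpace

theorem coord_eq_sum (a : Coord d) : a = ∑ i, a i • stdVec i := by
  conv_lhs => rw [← (EuclideanSpace.basisFun (Fin d) ℝ).sum_repr a]
  simp [stdVec]

theorem stdVec_apply (i j : Fin d) : (stdVec i : Coord d) j = if j = i then 1 else 0 := by
  simp [stdVec]

theorem fderiv_eq_sum_pd (φ : Coord d → ℝ) (v a : Coord d) :
    fderiv ℝ φ v a = ∑ i, a i * pd i φ v := by
  conv_lhs => rw [coord_eq_sum a]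
  simp [pd]

theorem fderiv_component {F : E → Coord d} {u : E}
    (hF : DifferentiableAt ℝ F u) (α : Fin d) (a : E) :
    fderiv ℝ (fun w => F w α) u a = fderiv ℝ F u a α :=
  congrArg (· a) ((EuclideanSpace.proj (𝕜 := ℝ) α).hasFDerivAt.comp u hF.hasFDerivAt).fderiv

/-- The bilinear form on `ℝᵈ` with a given matrix, as a continuous bilinear map so that families of
such forms can be differentiated. -/
def bil (M : Matrix (Fin d) (Fin d) ℝ) : Coord d →L[ℝ] Coord d →L[ℝ] ℝ :=
  ∑ α, ∑ β, M α β • (EuclideanSpace.proj (𝕜 := ℝ) α : Coord d →L[ℝ] ℝ).smulRight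
    (EuclideanSpace.proj (𝕜 := ℝ) β : Coord d →L[ℝ] ℝ)

theorem bil_apply (M : Matrix (Fin d) (Fin d) ℝ) (a b : Coord d) :
    bil M a b = ∑ α, ∑ β, M α β * (a α * b β) := by
  simp [bil]

theorem bil_stdVec (M : Matrix (Fin d) (Fin d) ℝ) (α β : Fin d) :
    bil M (stdVec α) (stdVec β) = M α β := by
  simp [bil_apply, stdVec_apply]

theorem bil_eq_dotProduct (M : Matrix (Fin d) (Fin d) ℝ) (a b : Coord d) :
    bil M a b = a.ofLp ⬝ᵥ M *ᵥ b.ofLp := by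
  simp only [bil_apply, dotProduct, Matrix.mulVec, Finset.mul_sum, mul_left_comm]

theorem bil_comm {M : Matrix (Fin d) (Fin d) ℝ} (hM : M.IsSymm) (a b : Coord d) :
    bil M a b = bil M b a := by
  rw [bil_eq_dotProduct, bil_eq_dotProduct, Matrix.dotProduct_mulVec, dotProduct_comm,
    ← Matrix.mulVec_transpose, hM.eq]

theorem eq_of_bil_eq {M : Matrix (Fin d) (Fin d) ℝ} (hM : IsUnit M.det) {a b : Coord d}
    (h : ∀ c, bil M c a = bil M c b) : a = b := by
  refine WithLp.ofLp_injective 2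
    (Matrix.mulVec_injective_of_isUnit ((Matrix.isUnit_iff_isUnit_det M).2 hM) ?_)
  ext i
  simpa [bil_eq_dotProduct, stdVec] using h (stdVec i)

theorem hasFDerivAt_bil {G : E → Matrix (Fin d) (Fin d) ℝ} {v : E}
    (hG : ∀ α β, DifferentiableAt ℝ (fun w => G w α β) v) :
    HasFDerivAt (fun w => bil (G w)) (∑ α, ∑ β, (fderiv ℝ (fun w => G w α β) v).smulRight
      ((EuclideanSpace.proj (𝕜 := ℝ) α : Coord d →L[ℝ] ℝ).smulRight
        (EuclideanSpace.proj (𝕜 := ℝ) β : Coord d →L[ℝ] ℝ))) v :=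
  HasFDerivAt.fun_sum fun α _ => HasFDerivAt.fun_sum fun β _ =>
    (hG α β).hasFDerivAt.smul_const (_ : Coord d →L[ℝ] Coord d →L[ℝ] ℝ)

theorem fderiv_bil {G : E → Matrix (Fin d) (Fin d) ℝ} {v : E}
    (hG : ∀ α β, DifferentiableAt ℝ (fun w => G w α β) v) (c : E) :
    fderiv ℝ (fun w => bil (G w)) v c =
      bil (Matrix.of fun α β => fderiv ℝ (fun w => G w α β) v c) := by
  rw [(hasFDerivAt_bil hG).fderiv]
  simp [bil]

end CoordinateSpace

section Koszul

variable {E F : Type*} [NormedAddCommGroup E] [NormedSpace ℝ E] [NormedAddCommGroup F]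
  [NormedSpace ℝ F]

/-- The right-hand side of the Koszul formula for constant vector fields: if `T` is the derivative
of a metric `B`, with `T a b c = DB(a)(b, c)`, then `koszul T a b c = B (∇_a b, c)`. -/
def koszul (T : E →L[ℝ] E →L[ℝ] E →L[ℝ] ℝ) : E →ₗ[ℝ] E →ₗ[ℝ] E →L[ℝ] ℝ :=
  LinearMap.mk₂ ℝ (fun a b => (1 / 2 : ℝ) • ((T a).flip b + (T b).flip a - (T.flip a).flip b))
    (fun _ _ _ => by ext; simp; ring) (fun _ _ _ => by ext; simp; ring)
    (fun _ _ _ => by ext; simp; ring) (fun _ _ _ => by ext; simp; ring)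

theorem koszul_apply (T : E →L[ℝ] E →L[ℝ] E →L[ℝ] ℝ) (a b c : E) :
    koszul T a b c = (1 / 2) * (T a c b + T b c a - T c a b) := by
  simp [koszul]

variable {B : E → E →L[ℝ] E →L[ℝ] ℝ} {B' : F → F →L[ℝ] F →L[ℝ] ℝ} {ψ : E → F} {v : E}

theorem fderiv_of_eventually_pullback (hψ : ContDiffAt ℝ 2 ψ v) (hB : DifferentiableAt ℝ B v)
    (hB' : DifferentiableAt ℝ B' (ψ v))
    (h : ∀ᶠ w in nhds v, ∀ a b, B w a b = B' (ψ w) (fderiv ℝ ψ w a) (fderiv ℝ ψ w b))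
    (c a b : E) :
    fderiv ℝ B v c a b =
      fderiv ℝ B' (ψ v) (fderiv ℝ ψ v c) (fderiv ℝ ψ v a) (fderiv ℝ ψ v b) +
      B' (ψ v) (fderiv ℝ (fderiv ℝ ψ) v c a) (fderiv ℝ ψ v b) +
      B' (ψ v) (fderiv ℝ ψ v a) (fderiv ℝ (fderiv ℝ ψ) v c b) := by
  have hDψ : DifferentiableAt ℝ (fderiv ℝ ψ) v :=
    (hψ.fderiv_right (m := 1) (by norm_num)).differentiableAt one_ne_zero
  have hDψ_apply (z : E) := hDψ.hasFDerivAt.clm_apply (hasFDerivAt_const z v)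
  have hleft := (hB.hasFDerivAt.clm_apply (hasFDerivAt_const a v)).clm_apply (hasFDerivAt_const b v)
  have hright := ((hB'.hasFDerivAt.comp v
    (hψ.differentiableAt two_ne_zero).hasFDerivAt).clm_apply (hDψ_apply a)).clm_apply (hDψ_apply b)
  have heq := congrArg (· c)
    ((hleft.congr_of_eventuallyEq (h.mono fun w hw => (hw a b).symm)).unique hright)
  simp only [ContinuousLinearMap.comp_zero, zero_add, ContinuousLinearMap.flip_apply,
    Function.comp_apply, ContinuousLinearMap.flip_add, add_apply,
    ContinuousLinearMap.comp_apply] at heq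
  linarith

theorem koszul_of_eventually_pullback (hψ : ContDiffAt ℝ 2 ψ v) (hB : DifferentiableAt ℝ B v)
    (hB' : DifferentiableAt ℝ B' (ψ v)) (hsymm : ∀ a b, B' (ψ v) a b = B' (ψ v) b a)
    (h : ∀ᶠ w in nhds v, ∀ a b, B w a b = B' (ψ w) (fderiv ℝ ψ w a) (fderiv ℝ ψ w b))
    (a b c : E) :
    koszul (fderiv ℝ B v) a b c =
      koszul (fderiv ℝ B' (ψ v)) (fderiv ℝ ψ v a) (fderiv ℝ ψ v b) (fderiv ℝ ψ v c) +
      B' (ψ v) (fderiv ℝ ψ v c) (fderiv ℝ (fderiv ℝ ψ) v a b) := by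
  have hD2 (a b : E) : fderiv ℝ (fderiv ℝ ψ) v a b = fderiv ℝ (fderiv ℝ ψ) v b a :=
    (hψ.isSymmSndFDerivAt (by simp)).eq a b
  simp only [koszul_apply, fderiv_of_eventually_pullback hψ hB hB' h, hD2 c, hD2 b a,
    hsymm (fderiv ℝ (fderiv ℝ ψ) v a c), hsymm (fderiv ℝ (fderiv ℝ ψ) v b c)]
  ring

end Koszul

section Christoffel

variable {d : ℕ} {G : Coord d → Matrix (Fin d) (Fin d) ℝ} {v : Coord d}

/-- The Christoffel symbols of a matrix-valued function `G` on `ℝᵈ`, i.e. of the metric with these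
coefficients; `christoffel y` is the case `G = gram y`. -/
def christoffelOf (G : Coord d → Matrix (Fin d) (Fin d) ℝ) (α β γ : Fin d) (v : Coord d) : ℝ :=
  (1 / 2) * ∑ δ, (G v)⁻¹ α δ *
    (pd β (fun w => G w δ γ) v + pd γ (fun w => G w δ β) v - pd δ (fun w => G w β γ) v)

/-- The vector `Γ(a, b)` with components `Γ^α_{βγ} a^β b^γ`, by which the covariant derivative of
`b` in the direction `a` differs from the coordinate derivative. -/
def christoffelVec (G : Coord d → Matrix (Fin d) (Fin d) ℝ) (v a b : Coord d) : Coord d :=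
  WithLp.toLp 2 fun α => ∑ β, ∑ γ, christoffelOf G α β γ v * (a β * b γ)

theorem christoffelOf_eq_mulVec (hG : ∀ α β, DifferentiableAt ℝ (fun w => G w α β) v)
    (α β γ : Fin d) :
    christoffelOf G α β γ v = ((G v)⁻¹ *ᵥ fun δ =>
      koszul (fderiv ℝ (fun w => bil (G w)) v) (stdVec β) (stdVec γ) (stdVec δ)) α := by
  simp only [christoffelOf, Matrix.mulVec, dotProduct, koszul_apply, fderiv_bil hG, bil_stdVec,
    Matrix.of_apply, Finset.mul_sum, pd, mul_left_comm]

theorem christoffelVec_eq_mulVec (hG : ∀ α β, DifferentiableAt ℝ (fun w => G w α β) v)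
    (a b : Coord d) :
    (christoffelVec G v a b).ofLp =
      (G v)⁻¹ *ᵥ fun δ => koszul (fderiv ℝ (fun w => bil (G w)) v) a b (stdVec δ) := by
  set K := koszul (fderiv ℝ (fun w => bil (G w)) v)
  have hK (δ : Fin d) : K a b (stdVec δ) =
      ∑ β, ∑ γ, (a β * b γ) * K (stdVec β) (stdVec γ) (stdVec δ) := by
    conv_lhs => rw [coord_eq_sum a, coord_eq_sum b]
    simp only [map_sum, map_smul, LinearMap.sum_apply, LinearMap.smul_apply,
      sum_apply, smul_apply, smul_eq_mul, Finset.mul_sum,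
      mul_assoc, mul_left_comm (b _)]
    exact Finset.sum_comm
  ext α
  simp only [christoffelVec, christoffelOf_eq_mulVec hG, Matrix.mulVec, dotProduct, hK,
    Finset.mul_sum, Finset.sum_mul]
  rw [Finset.sum_comm_cycle]
  exact Finset.sum_congr rfl fun _ _ => Finset.sum_congr rfl fun _ _ =>
    Finset.sum_congr rfl fun _ _ => by ring

theorem bil_christoffelVec (hG : ∀ α β, DifferentiableAt ℝ (fun w => G w α β) v)
    (hdet : IsUnit (G v).det) (a b c : Coord d) :
    bil (G v) c (christoffelVec G v a b) =
      koszul (fderiv ℝ (fun w => bil (G w)) v) a b c := by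
  rw [bil_eq_dotProduct, christoffelVec_eq_mulVec hG, Matrix.mulVec_mulVec,
    Matrix.mul_nonsing_inv _ hdet, Matrix.one_mulVec]
  conv_rhs => rw [coord_eq_sum c]
  simp [dotProduct]

theorem fderiv_christoffelVec {G' : Coord d → Matrix (Fin d) (Fin d) ℝ}
    {ψ : Coord d → Coord d} (hψ : ContDiffAt ℝ 2 ψ v)
    (hG : ∀ α β, DifferentiableAt ℝ (fun w => G w α β) v)
    (hG' : ∀ α β, DifferentiableAt ℝ (fun w => G' w α β) (ψ v))
    (hdet : IsUnit (G v).det) (hdet' : IsUnit (G' (ψ v)).det)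
    (hsymm : (G' (ψ v)).IsSymm) (hsurj : Function.Surjective (fderiv ℝ ψ v))
    (h : ∀ᶠ w in nhds v, ∀ a b,
      bil (G w) a b = bil (G' (ψ w)) (fderiv ℝ ψ w a) (fderiv ℝ ψ w b)) (a b : Coord d) :
    fderiv ℝ ψ v (christoffelVec G v a b) = fderiv ℝ (fderiv ℝ ψ) v a b +
      christoffelVec G' (ψ v) (fderiv ℝ ψ v a) (fderiv ℝ ψ v b) := by
  refine eq_of_bil_eq hdet' fun z => ?_
  obtain ⟨c, rfl⟩ := hsurj z
  rw [← h.self_of_nhds, bil_christoffelVec hG hdet, map_add, bil_christoffelVec hG' hdet',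
    koszul_of_eventually_pullback hψ (hasFDerivAt_bil hG).differentiableAt
      (hasFDerivAt_bil hG').differentiableAt (bil_comm hsymm) h, add_comm]

theorem sum_christoffelOf (hsymm : (G v).IsSymm) (γ : Fin d) :
    ∑ β, christoffelOf G β β γ v =
      (1 / 2) * ((G v)⁻¹ * Matrix.of fun α β => pd γ (fun w => G w α β) v).trace := by
  have hinv (α β : Fin d) : (G v)⁻¹ α β = (G v)⁻¹ β α := by
    have hsymm_inv : ((G v)⁻¹).IsSymm := by
      rw [Matrix.IsSymm, Matrix.transpose_nonsing_inv, hsymm.eq]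
    exact hsymm_inv.apply β α
  have hcancel : ∑ β, ∑ δ, (G v)⁻¹ β δ * pd β (fun w => G w δ γ) v =
      ∑ β, ∑ δ, (G v)⁻¹ β δ * pd δ (fun w => G w β γ) v := by
    rw [Finset.sum_comm]
    exact Finset.sum_congr rfl fun β _ => Finset.sum_congr rfl fun δ _ => by rw [hinv]
  simp only [christoffelOf, ← Finset.mul_sum, mul_add, mul_sub, Finset.sum_add_distrib,
    Finset.sum_sub_distrib, hcancel, Matrix.trace, Matrix.diag_apply, Matrix.mul_apply,
    Matrix.of_apply]
  ring

end Christoffel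

section Charts

variable {d : ℕ} {M : Type*} [TopologicalSpace M] {y y' : OpenPartialHomeomorph M (Coord d)}
  {q : M} {v : Coord d}

theorem eventually_mem_transition (hv : v ∈ y.target) (hv' : y.symm v ∈ y'.source) :
    ∀ᶠ w in nhds v, w ∈ y.target ∧ y.symm w ∈ y'.source :=
  (y.symm.isOpen_inter_preimage y'.open_source).mem_nhds ⟨hv, hv'⟩

variable [ChartedSpace (Coord d) M]

/-- The differential of a chart, with values in `ℝᵈ`. -/
def dchart (y : OpenPartialHomeomorph M (Coord d)) (q : M) :
    TangentSpace (𝓡 d) q →ₗ[ℝ] Coord d :=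
  (mfderiv (𝓡 d) (𝓡 d) y q).toLinearMap

/-- The differential of the inverse of a chart. -/
def dsymm (y : OpenPartialHomeomorph M (Coord d)) (v : Coord d) :
    Coord d →ₗ[ℝ] TangentSpace (𝓡 d) (y.symm v) :=
  (mfderiv (𝓡 d) (𝓡 d) y.symm v).toLinearMap

theorem comp_eq_dchart (y : OpenPartialHomeomorph M (Coord d)) (q : M) (α : Fin d)
    (z : TangentSpace (𝓡 d) q) : comp y q α z = dchart y q z α := rfl

theorem mdifferentiable_of_mem_maximalAtlas (hy : y ∈ IsManifold.maximalAtlas (𝓡 d) ∞ M) :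
    y.MDifferentiable (𝓡 d) (𝓡 d) :=
  ⟨(contMDiffOn_of_mem_maximalAtlas hy).mdifferentiableOn (by simp),
    (contMDiffOn_symm_of_mem_maximalAtlas hy).mdifferentiableOn (by simp)⟩

theorem contDiffAt_transition (hy : y ∈ IsManifold.maximalAtlas (𝓡 d) ∞ M)
    (hy' : y' ∈ IsManifold.maximalAtlas (𝓡 d) ∞ M) (hv : v ∈ y.target)
    (hv' : y.symm v ∈ y'.source) : ContDiffAt ℝ ∞ (y' ∘ y.symm) v :=
  ((contMDiffAt_of_mem_maximalAtlas hy' hv').comp v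
    (contMDiffAt_symm_of_mem_maximalAtlas hy hv)).contDiffAt

theorem isInvertible_mfderiv (hy : y ∈ IsManifold.maximalAtlas (𝓡 d) ∞ M) (hq : q ∈ y.source) :
    (mfderiv (𝓡 d) (𝓡 d) y q).IsInvertible :=
  ⟨(mdifferentiable_of_mem_maximalAtlas hy).mfderiv hq, rfl⟩

theorem dchart_injective (hy : y ∈ IsManifold.maximalAtlas (𝓡 d) ∞ M) (hq : q ∈ y.source) :
    Function.Injective (dchart y q) :=
  (isInvertible_mfderiv hy hq).injective

theorem dchart_frame (hy : y ∈ IsManifold.maximalAtlas (𝓡 d) ∞ M) (hq : q ∈ y.source)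
    (α : Fin d) : dchart y q (frame y q α) = stdVec α :=
  (isInvertible_mfderiv hy hq).self_apply_inverse (stdVec α)

theorem dchart_dsymm (hy : y ∈ IsManifold.maximalAtlas (𝓡 d) ∞ M) (hv : v ∈ y.target)
    (a : Coord d) : dchart y (y.symm v) (dsymm y v a) = a :=
  congrArg (· a) ((mdifferentiable_of_mem_maximalAtlas hy).comp_symm_deriv hv)

theorem dsymm_dchart (hy : y ∈ IsManifold.maximalAtlas (𝓡 d) ∞ M) (hv : v ∈ y.target)
    (z : TangentSpace (𝓡 d) (y.symm v)) : dsymm y v (dchart y (y.symm v) z) = z :=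
  dchart_injective hy (y.map_target hv) (dchart_dsymm hy hv _)

theorem dsymm_stdVec (hy : y ∈ IsManifold.maximalAtlas (𝓡 d) ∞ M) (hv : v ∈ y.target)
    (α : Fin d) : dsymm y v (stdVec α) = frame y (y.symm v) α := by
  rw [← dchart_frame hy (y.map_target hv), dsymm_dchart hy hv]

/-- The coordinate frame as a basis of the tangent space. -/
def frameBasis (hy : y ∈ IsManifold.maximalAtlas (𝓡 d) ∞ M) (hq : q ∈ y.source) :
    Module.Basis (Fin d) ℝ (TangentSpace (𝓡 d) q) :=
  (EuclideanSpace.basisFun (Fin d) ℝ).toBasis.map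
    (LinearEquiv.ofBijective (dchart y q) (isInvertible_mfderiv hy hq).bijective).symm

theorem frameBasis_repr (hy : y ∈ IsManifold.maximalAtlas (𝓡 d) ∞ M) (hq : q ∈ y.source)
    (z : TangentSpace (𝓡 d) q) (α : Fin d) : (frameBasis hy hq).repr z α = dchart y q z α :=
  rfl

theorem coe_frameBasis (hy : y ∈ IsManifold.maximalAtlas (𝓡 d) ∞ M) (hq : q ∈ y.source) :
    ⇑(frameBasis hy hq) = frame y q := by
  ext1 α
  refine (frameBasis hy hq).repr.injective (Finsupp.ext fun β => ?_)
  rw [frameBasis_repr, frameBasis_repr, dchart_frame hy hq, ← frameBasis_repr hy hq,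
    Module.Basis.repr_self, stdVec_apply, Finsupp.single_apply]
  simp only [eq_comm]

theorem dchart_comp_dsymm (hy : y ∈ IsManifold.maximalAtlas (𝓡 d) ∞ M)
    (hy' : y' ∈ IsManifold.maximalAtlas (𝓡 d) ∞ M) (hv : v ∈ y.target)
    (hv' : y.symm v ∈ y'.source) (a : Coord d) :
    dchart y' (y.symm v) (dsymm y v a) = fderiv ℝ (y' ∘ y.symm) v a := by
  rw [← mfderiv_eq_fderiv,
    mfderiv_comp v ((mdifferentiable_of_mem_maximalAtlas hy').mdifferentiableAt hv')
      ((mdifferentiable_of_mem_maximalAtlas hy).mdifferentiableAt_symm hv)]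
  rfl

theorem dchart_eq_fderiv_transition (hy : y ∈ IsManifold.maximalAtlas (𝓡 d) ∞ M)
    (hy' : y' ∈ IsManifold.maximalAtlas (𝓡 d) ∞ M) (hq : q ∈ y.source) (hq' : q ∈ y'.source)
    (z : TangentSpace (𝓡 d) q) :
    dchart y' q z = fderiv ℝ (y' ∘ y.symm) (y q) (dchart y q z) := by
  obtain ⟨v, hv, rfl⟩ : ∃ v ∈ y.target, y.symm v = q := ⟨y q, y.map_source hq, y.left_inv hq⟩
  rw [y.right_inv hv, ← dchart_comp_dsymm hy hy' hv hq', dsymm_dchart hy hv]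

theorem fderiv_transition_bijective (hy : y ∈ IsManifold.maximalAtlas (𝓡 d) ∞ M)
    (hy' : y' ∈ IsManifold.maximalAtlas (𝓡 d) ∞ M) (hv : v ∈ y.target)
    (hv' : y.symm v ∈ y'.source) : Function.Bijective (fderiv ℝ (y' ∘ y.symm) v) := by
  have hfactor : (fderiv ℝ (y' ∘ y.symm) v : Coord d → Coord d) =
      dchart y' (y.symm v) ∘ dsymm y v :=
    funext fun a => (dchart_comp_dsymm hy hy' hv hv' a).symm
  rw [hfactor]
  exact (isInvertible_mfderiv hy' hv').bijective.comp
    ((mdifferentiable_of_mem_maximalAtlas hy).symm.mfderiv_bijective hv)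

theorem contMDiffOn_dsymm [IsManifold (𝓡 d) ∞ M]
    (hy : y ∈ IsManifold.maximalAtlas (𝓡 d) ∞ M) (a : Coord d) :
    ContMDiffOn (𝓡 d) (𝓡 d).tangent ∞
      (fun v => (⟨y.symm v, dsymm y v a⟩ : TangentBundle (𝓡 d) M)) y.target := by
  have htangentMap := (contMDiffOn_symm_of_mem_maximalAtlas hy).contMDiffOn_tangentMapWithin
    (m := ∞) (by rfl) y.open_target.uniqueMDiffOn
  have hconst : ContMDiff (𝓡 d) (𝓡 d).tangent ∞
      (fun v : Coord d => (⟨v, a⟩ : TangentBundle (𝓡 d) (Coord d))) :=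
    contMDiff_vectorSpace_iff_contDiff.2 contDiff_const
  refine (htangentMap.comp hconst.contMDiffOn fun v hv => hv).congr fun v hv => ?_
  simp only [Function.comp_apply, tangentMapWithin, dsymm]
  rw [mfderivWithin_of_isOpen y.open_target hv]
  rfl

end Charts

section Metric

variable {d : ℕ} {M : Type*} [TopologicalSpace M] [ChartedSpace (Coord d) M]
  [RiemannianBundle (fun p : M => TangentSpace (𝓡 d) p)]
  {y y' : OpenPartialHomeomorph M (Coord d)} {q : M} {v : Coord d}

theorem isSymm_gram (y : OpenPartialHomeomorph M (Coord d)) (v : Coord d) :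
    (gram y v).IsSymm :=
  Matrix.IsSymm.ext fun α β => real_inner_comm (frame y (y.symm v) α) (frame y (y.symm v) β)

theorem bil_gram (hy : y ∈ IsManifold.maximalAtlas (𝓡 d) ∞ M) (hv : v ∈ y.target)
    (a b : Coord d) : bil (gram y v) a b = inner ℝ (dsymm y v a) (dsymm y v b) := by
  conv_rhs => rw [coord_eq_sum a, coord_eq_sum b]
  simp only [map_sum, map_smul, dsymm_stdVec hy hv, sum_inner, inner_sum, real_inner_smul_left,
    real_inner_smul_right, bil_apply, gram, Matrix.of_apply]
  rw [Finset.sum_comm]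
  exact Finset.sum_congr rfl fun _ _ => Finset.sum_congr rfl fun _ _ => by
    rw [real_inner_comm]
    ring

theorem bil_gram_dchart (hy : y ∈ IsManifold.maximalAtlas (𝓡 d) ∞ M) (hq : q ∈ y.source)
    (z z' : TangentSpace (𝓡 d) q) :
    bil (gram y (y q)) (dchart y q z) (dchart y q z') = inner ℝ z z' := by
  obtain ⟨v, hv, rfl⟩ : ∃ v ∈ y.target, y.symm v = q := ⟨y q, y.map_source hq, y.left_inv hq⟩
  rw [y.right_inv hv, bil_gram hy hv, dsymm_dchart hy hv, dsymm_dchart hy hv]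

theorem bil_gram_transition (hy : y ∈ IsManifold.maximalAtlas (𝓡 d) ∞ M)
    (hy' : y' ∈ IsManifold.maximalAtlas (𝓡 d) ∞ M) (hv : v ∈ y.target)
    (hv' : y.symm v ∈ y'.source) (a b : Coord d) :
    bil (gram y' ((y' ∘ y.symm) v)) (fderiv ℝ (y' ∘ y.symm) v a) (fderiv ℝ (y' ∘ y.symm) v b) =
      bil (gram y v) a b := by
  rw [← dchart_comp_dsymm hy hy' hv hv', ← dchart_comp_dsymm hy hy' hv hv', bil_gram hy hv]
  exact bil_gram_dchart hy' hv' _ _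

theorem det_gram_eq_volumeForm_sq (y : OpenPartialHomeomorph M (Coord d)) (v : Coord d)
    (o : Orientation ℝ (TangentSpace (𝓡 d) (y.symm v)) (Fin d)) :
    (gram y v).det = o.volumeForm (frame y (y.symm v)) ^ 2 :=
  (volumeForm_sq o _).symm

theorem det_gram_pos (hy : y ∈ IsManifold.maximalAtlas (𝓡 d) ∞ M) (hv : v ∈ y.target) :
    0 < (gram y v).det := by
  have hli : LinearIndependent ℝ (frame y (y.symm v)) :=
    coe_frameBasis hy (y.map_target hv) ▸ (frameBasis hy (y.map_target hv)).linearIndependent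
  exact (Matrix.posDef_gram_of_linearIndependent hli).det_pos

theorem density_pos (hy : y ∈ IsManifold.maximalAtlas (𝓡 d) ∞ M) (hv : v ∈ y.target) :
    0 < density y v :=
  Real.sqrt_pos.2 (det_gram_pos hy hv)

theorem volumeForm_frame_of_isPositiveChart
    {o : ∀ p : M, Orientation ℝ (TangentSpace (𝓡 d) p) (Fin d)} (hpos : IsPositiveChart o y)
    (hv : v ∈ y.target) : (o (y.symm v)).volumeForm (frame y (y.symm v)) = density y v := by
  rw [density, det_gram_eq_volumeForm_sq y v (o (y.symm v)),
    Real.sqrt_sq (hpos _ (y.map_target hv)).le]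

variable [IsManifold (𝓡 d) ∞ M]
  [IsContMDiffRiemannianBundle (𝓡 d) ∞ (Coord d) (fun p : M => TangentSpace (𝓡 d) p)]

theorem contDiffAt_gram (hy : y ∈ IsManifold.maximalAtlas (𝓡 d) ∞ M) (hv : v ∈ y.target)
    (α β : Fin d) : ContDiffAt ℝ ∞ (fun v => gram y v α β) v := by
  have hinner := (contMDiffOn_dsymm hy (stdVec α)).inner_bundle (contMDiffOn_dsymm hy (stdVec β))
  refine ((contMDiffOn_iff_contDiffOn.1 hinner).congr fun w hw => ?_).contDiffAt
    (y.open_target.mem_nhds hv)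
  simp only [gram, Matrix.of_apply, dsymm_stdVec hy hw]

theorem differentiableAt_gram (hy : y ∈ IsManifold.maximalAtlas (𝓡 d) ∞ M) (hv : v ∈ y.target)
    (α β : Fin d) : DifferentiableAt ℝ (fun v => gram y v α β) v :=
  (contDiffAt_gram hy hv α β).differentiableAt (by simp)

theorem contDiffAt_density (hy : y ∈ IsManifold.maximalAtlas (𝓡 d) ∞ M) (hv : v ∈ y.target) :
    ContDiffAt ℝ ∞ (density y) v :=
  (contDiffAt_det (contDiffAt_gram hy hv)).sqrt (det_gram_pos hy hv).ne'

theorem continuousOn_density (hy : y ∈ IsManifold.maximalAtlas (𝓡 d) ∞ M) :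
    ContinuousOn (density y) y.target :=
  fun _ hv => (contDiffAt_density hy hv).continuousAt.continuousWithinAt

theorem continuousOn_source_of_continuousOn_mul_density {g : M → ℝ}
    (hy : y ∈ IsManifold.maximalAtlas (𝓡 d) ∞ M)
    (hg : ContinuousOn (fun v => g (y.symm v) * density y v) y.target) :
    ContinuousOn g y.source := by
  have hquot : ContinuousOn (fun v => g (y.symm v) * density y v / density y v) y.target :=
    hg.div (continuousOn_density hy) fun v hv => (density_pos hy hv).ne'
  refine (hquot.comp y.continuousOn y.mapsTo).congr fun q hq => ?_
  rw [Function.comp_apply, mul_div_cancel_right₀ _ (density_pos hy (y.map_source hq)).ne',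
    y.left_inv hq]

theorem pd_density (hy : y ∈ IsManifold.maximalAtlas (𝓡 d) ∞ M) (hv : v ∈ y.target)
    (γ : Fin d) : pd γ (density y) v = density y v * ∑ β, christoffel y β β γ v :=
  (fderiv_sqrt_det (differentiableAt_gram hy hv) (det_gram_pos hy hv) (stdVec γ)).trans
    (congrArg (density y v * ·) (sum_christoffelOf (isSymm_gram y v) γ).symm)

theorem fderiv_transition_christoffelVec (hy : y ∈ IsManifold.maximalAtlas (𝓡 d) ∞ M)
    (hy' : y' ∈ IsManifold.maximalAtlas (𝓡 d) ∞ M) (hv : v ∈ y.target)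
    (hv' : y.symm v ∈ y'.source) (a b : Coord d) :
    fderiv ℝ (y' ∘ y.symm) v (christoffelVec (gram y) v a b) =
      fderiv ℝ (fderiv ℝ (y' ∘ y.symm)) v a b +
      christoffelVec (gram y') ((y' ∘ y.symm) v) (fderiv ℝ (y' ∘ y.symm) v a)
        (fderiv ℝ (y' ∘ y.symm) v b) := by
  have htarget : (y' ∘ y.symm) v ∈ y'.target := y'.map_source hv'
  refine fderiv_christoffelVec ((contDiffAt_transition hy hy' hv hv').of_le (by norm_cast))
    (differentiableAt_gram hy hv) (differentiableAt_gram hy' htarget)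
    (det_gram_pos hy hv).ne'.isUnit (det_gram_pos hy' htarget).ne'.isUnit (isSymm_gram y' _)
    (fderiv_transition_bijective hy hy' hv hv').2 ?_ a b
  filter_upwards [eventually_mem_transition hv hv'] with w hw a b
  exact (bil_gram_transition hy hy' hw.1 hw.2 a b).symm

end Metric

section Maps

variable {d : ℕ} {M₁ M₂ : Type*} [TopologicalSpace M₁] [TopologicalSpace M₂] {f : M₁ → M₂}

theorem isOpen_coordDomain (hf : Continuous f) (x : OpenPartialHomeomorph M₁ (Coord d))
    (y : OpenPartialHomeomorph M₂ (Coord d)) : IsOpen (coordDomain f x y) :=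
  x.symm.isOpen_inter_preimage (y.open_source.preimage hf)

variable {x : OpenPartialHomeomorph M₁ (Coord d)} {y y' : OpenPartialHomeomorph M₂ (Coord d)}
  {u : Coord d}

theorem coordRep_mem_target (hu : u ∈ coordDomain f x y) : coordRep f x y u ∈ y.target :=
  y.map_source hu.2

theorem symm_coordRep_mem_source (hu : u ∈ coordDomain f x y) (hu' : u ∈ coordDomain f x y') :
    y.symm (coordRep f x y u) ∈ y'.source := by
  rw [coordRep, y.left_inv hu.2]
  exact hu'.2

theorem coordRep_eventuallyEq_transition (hf : Continuous f) (hu : u ∈ coordDomain f x y)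
    (y' : OpenPartialHomeomorph M₂ (Coord d)) :
    coordRep f x y' =ᶠ[nhds u] (y' ∘ y.symm) ∘ coordRep f x y := by
  filter_upwards [(isOpen_coordDomain hf x y).mem_nhds hu] with w hw
  simp only [Function.comp_apply, coordRep, y.left_inv hw.2]

variable [ChartedSpace (Coord d) M₂] {ξ : ∀ p, TangentSpace (𝓡 d) (f p)}

/-- The coordinate components, in the charts `x` and `y`, of a vector field along `f`. -/
def fieldRep (f : M₁ → M₂) (x : OpenPartialHomeomorph M₁ (Coord d))
    (y : OpenPartialHomeomorph M₂ (Coord d)) (ξ : ∀ p, TangentSpace (𝓡 d) (f p)) (u : Coord d) :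
    Coord d :=
  dchart y (f (x.symm u)) (ξ (x.symm u))

theorem fieldRep_eq_fderiv_transition (hy : y ∈ IsManifold.maximalAtlas (𝓡 d) ∞ M₂)
    (hy' : y' ∈ IsManifold.maximalAtlas (𝓡 d) ∞ M₂) (hu : u ∈ coordDomain f x y)
    (hu' : u ∈ coordDomain f x y') :
    fieldRep f x y' ξ u = fderiv ℝ (y' ∘ y.symm) (coordRep f x y u) (fieldRep f x y ξ u) :=
  dchart_eq_fderiv_transition hy hy' hu.2 hu'.2 _

variable [ChartedSpace (Coord d) M₁]

theorem contDiffAt_coordRep {n : WithTop ℕ∞} (hn : n ≤ ∞)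
    (hf : ContMDiffAt (𝓡 d) (𝓡 d) n f (x.symm u)) (hx : x ∈ IsManifold.maximalAtlas (𝓡 d) ∞ M₁)
    (hy : y ∈ IsManifold.maximalAtlas (𝓡 d) ∞ M₂) (hu : u ∈ coordDomain f x y) :
    ContDiffAt ℝ n (coordRep f x y) u :=
  (((contMDiffAt_of_mem_maximalAtlas hy hu.2).of_le hn).comp u
    (hf.comp u ((contMDiffAt_symm_of_mem_maximalAtlas hx hu.1).of_le hn))).contDiffAt

theorem divCof_eq_zero (hf : ContMDiff (𝓡 d) (𝓡 d) 2 f)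
    (hx : x ∈ IsManifold.maximalAtlas (𝓡 d) ∞ M₁) (hy : y ∈ IsManifold.maximalAtlas (𝓡 d) ∞ M₂)
    (hu : u ∈ coordDomain f x y) (γ : Fin d) : divCof f x y γ u = 0 :=
  sum_pd_adjugate_jacobian (contDiffAt_coordRep (by norm_cast) (hf _) hx hy hu) γ

theorem dchart_mfderiv_dsymm (hf : MDifferentiableAt (𝓡 d) (𝓡 d) f (x.symm u))
    (hx : x ∈ IsManifold.maximalAtlas (𝓡 d) ∞ M₁) (hy : y ∈ IsManifold.maximalAtlas (𝓡 d) ∞ M₂)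
    (hu : u ∈ coordDomain f x y) (a : Coord d) :
    dchart y (f (x.symm u)) (mfderiv (𝓡 d) (𝓡 d) f (x.symm u) (dsymm x u a)) =
      fderiv ℝ (coordRep f x y) u a := by
  have hx' := (mdifferentiable_of_mem_maximalAtlas hx).mdifferentiableAt_symm hu.1
  have hy' := (mdifferentiable_of_mem_maximalAtlas hy).mdifferentiableAt hu.2
  have hchain := mfderiv_comp (g := y) u hy' (hf.comp u hx')
  rw [mfderiv_comp u hf hx'] at hchain
  rw [← mfderiv_eq_fderiv]
  exact (congrArg (· a) hchain).symm

theorem toMatrix_mfderiv (hf : ContMDiffAt (𝓡 d) (𝓡 d) 1 f (x.symm u))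
    (hx : x ∈ IsManifold.maximalAtlas (𝓡 d) ∞ M₁) (hy : y ∈ IsManifold.maximalAtlas (𝓡 d) ∞ M₂)
    (hu : u ∈ coordDomain f x y) :
    LinearMap.toMatrix (frameBasis hx (x.map_target hu.1)) (frameBasis hy hu.2)
      (mfderiv (𝓡 d) (𝓡 d) f (x.symm u)).toLinearMap = jac f x y u := by
  have hdiff : DifferentiableAt ℝ (coordRep f x y) u :=
    (contDiffAt_coordRep (by norm_cast) hf hx hy hu).differentiableAt one_ne_zero
  ext α i
  rw [LinearMap.toMatrix_apply, frameBasis_repr, coe_frameBasis, ← dsymm_stdVec hx hu.1,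
    ContinuousLinearMap.coe_coe,
    dchart_mfderiv_dsymm (hf.mdifferentiableAt one_ne_zero) hx hy hu, ← fderiv_component hdiff]
  rfl

theorem mvfderiv_dsymm {E : Type*} [NormedAddCommGroup E] [NormedSpace ℝ E] {g : M₁ → E}
    (hx : x ∈ IsManifold.maximalAtlas (𝓡 d) ∞ M₁) (hu : u ∈ x.target)
    (hg : MDifferentiableAt (𝓡 d) 𝓘(ℝ, E) g (x.symm u)) (a : Coord d) :
    mvfderiv (𝓡 d) g (x.symm u) (dsymm x u a) = fderiv ℝ (fun w => g (x.symm w)) u a := by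
  have hchain :=
    mfderiv_comp u hg ((mdifferentiable_of_mem_maximalAtlas hx).mdifferentiableAt_symm hu)
  rw [← mfderiv_eq_fderiv]
  exact (congrArg (· a) hchain).symm

variable [IsManifold (𝓡 d) ∞ M₂]

theorem IsC1Along.contMDiff (hξ : IsC1Along f ξ) : ContMDiff (𝓡 d) (𝓡 d) 1 f :=
  (Bundle.contMDiff_proj (TangentSpace (𝓡 d) (M := M₂))).comp hξ

theorem IsC1Along.contMDiffAt_dchart (hξ : IsC1Along f ξ)
    (hy : y ∈ IsManifold.maximalAtlas (𝓡 d) ∞ M₂) {p : M₁} (hp : f p ∈ y.source) :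
    ContMDiffAt (𝓡 d) 𝓘(ℝ, Coord d) 1 (fun q => dchart y (f q) (ξ q)) p := by
  have htangentMap := (contMDiffOn_of_mem_maximalAtlas hy).contMDiffOn_tangentMapWithin
    (m := 1) (by norm_cast) y.open_source.uniqueMDiffOn
  have hsource : Bundle.TotalSpace.proj ⁻¹' y.source ∈
      nhds (⟨f p, ξ p⟩ : TangentBundle (𝓡 d) M₂) :=
    (y.open_source.preimage (FiberBundle.continuous_proj (Coord d) _)).mem_nhds hp
  have hcomp := (contMDiff_snd_tangentBundle_modelSpace (Coord d) (𝓡 d) (n := 1)).contMDiffAt.comp p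
    ((htangentMap.contMDiffAt hsource).comp p (hξ p))
  refine hcomp.congr_of_eventuallyEq ?_
  filter_upwards [hξ.continuous.continuousAt hsource] with q hq
  have hmfderiv : mfderivWithin (𝓡 d) (𝓡 d) y y.source (f q) = mfderiv (𝓡 d) (𝓡 d) y (f q) :=
    mfderivWithin_of_isOpen y.open_source hq
  exact (congrArg (· (ξ q)) hmfderiv).symm

theorem IsC1Along.mdifferentiableAt_dchart (hξ : IsC1Along f ξ)
    (hy : y ∈ IsManifold.maximalAtlas (𝓡 d) ∞ M₂) {p : M₁} (hp : f p ∈ y.source) (β : Fin d) :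
    MDifferentiableAt (𝓡 d) 𝓘(ℝ, ℝ) (fun q => dchart y (f q) (ξ q) β) p :=
  ((EuclideanSpace.proj (𝕜 := ℝ) β : Coord d →L[ℝ] ℝ).contMDiff.contMDiffAt.comp _
    (hξ.contMDiffAt_dchart hy hp)).mdifferentiableAt one_ne_zero

theorem IsC1Along.contDiffAt_fieldRep (hξ : IsC1Along f ξ)
    (hx : x ∈ IsManifold.maximalAtlas (𝓡 d) ∞ M₁) (hy : y ∈ IsManifold.maximalAtlas (𝓡 d) ∞ M₂)
    (hu : u ∈ coordDomain f x y) : ContDiffAt ℝ 1 (fieldRep f x y ξ) u :=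
  ((hξ.contMDiffAt_dchart hy hu.2).comp u
    ((contMDiffAt_symm_of_mem_maximalAtlas hx hu.1).of_le (by norm_cast))).contDiffAt

theorem IsC1Along.differentiableAt_coordRep (hξ : IsC1Along f ξ)
    (hx : x ∈ IsManifold.maximalAtlas (𝓡 d) ∞ M₁) (hy : y ∈ IsManifold.maximalAtlas (𝓡 d) ∞ M₂)
    (hu : u ∈ coordDomain f x y) : DifferentiableAt ℝ (coordRep f x y) u :=
  (contDiffAt_coordRep (by norm_cast) (hξ.contMDiff _) hx hy hu).differentiableAt one_ne_zero

theorem IsC1Along.mvfderiv_dchart_dsymm (hξ : IsC1Along f ξ)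
    (hx : x ∈ IsManifold.maximalAtlas (𝓡 d) ∞ M₁) (hy : y ∈ IsManifold.maximalAtlas (𝓡 d) ∞ M₂)
    (hu : u ∈ coordDomain f x y) (β : Fin d) (a : Coord d) :
    mvfderiv (𝓡 d) (fun q => dchart y (f q) (ξ q) β) (x.symm u) (dsymm x u a) =
      fderiv ℝ (fieldRep f x y ξ) u a β := by
  rw [mvfderiv_dsymm hx hu.1 (hξ.mdifferentiableAt_dchart hy hu.2 β)]
  exact fderiv_component ((hξ.contDiffAt_fieldRep hx hy hu).differentiableAt one_ne_zero) β a

theorem IsC1Along.fderiv_coordRep_transition (hξ : IsC1Along f ξ)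
    (hx : x ∈ IsManifold.maximalAtlas (𝓡 d) ∞ M₁) (hy : y ∈ IsManifold.maximalAtlas (𝓡 d) ∞ M₂)
    (hy' : y' ∈ IsManifold.maximalAtlas (𝓡 d) ∞ M₂) (hu : u ∈ coordDomain f x y)
    (hu' : u ∈ coordDomain f x y') (a : Coord d) :
    fderiv ℝ (coordRep f x y') u a =
      fderiv ℝ (y' ∘ y.symm) (coordRep f x y u) (fderiv ℝ (coordRep f x y) u a) := by
  have hψ := contDiffAt_transition hy hy' (coordRep_mem_target hu) (symm_coordRep_mem_source hu hu')
  rw [(coordRep_eventuallyEq_transition hξ.contMDiff.continuous hu y').fderiv_eq,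
    fderiv_comp u (hψ.differentiableAt (by simp)) (hξ.differentiableAt_coordRep hx hy hu)]
  rfl

theorem IsC1Along.fderiv_fieldRep_transition (hξ : IsC1Along f ξ)
    (hx : x ∈ IsManifold.maximalAtlas (𝓡 d) ∞ M₁) (hy : y ∈ IsManifold.maximalAtlas (𝓡 d) ∞ M₂)
    (hy' : y' ∈ IsManifold.maximalAtlas (𝓡 d) ∞ M₂) (hu : u ∈ coordDomain f x y)
    (hu' : u ∈ coordDomain f x y') (a : Coord d) :
    fderiv ℝ (fieldRep f x y' ξ) u a =
      fderiv ℝ (y' ∘ y.symm) (coordRep f x y u) (fderiv ℝ (fieldRep f x y ξ) u a) +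
      fderiv ℝ (fderiv ℝ (y' ∘ y.symm)) (coordRep f x y u) (fderiv ℝ (coordRep f x y) u a)
        (fieldRep f x y ξ u) := by
  have hψ := contDiffAt_transition hy hy' (coordRep_mem_target hu) (symm_coordRep_mem_source hu hu')
  have hDψ : DifferentiableAt ℝ (fderiv ℝ (y' ∘ y.symm)) (coordRep f x y u) :=
    (hψ.fderiv_right (m := 1) (by norm_cast)).differentiableAt one_ne_zero
  have hfield : fieldRep f x y' ξ =ᶠ[nhds u]
      fun w => fderiv ℝ (y' ∘ y.symm) (coordRep f x y w) (fieldRep f x y ξ w) := by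
    filter_upwards [(isOpen_coordDomain hξ.contMDiff.continuous x y).mem_nhds hu,
      (isOpen_coordDomain hξ.contMDiff.continuous x y').mem_nhds hu'] with w hw hw'
    exact fieldRep_eq_fderiv_transition hy hy' hw hw'
  rw [hfield.fderiv_eq]
  exact congrArg (· a) ((hDψ.hasFDerivAt.comp u
    (hξ.differentiableAt_coordRep hx hy hu).hasFDerivAt).clm_apply
      ((hξ.contDiffAt_fieldRep hx hy hu).differentiableAt one_ne_zero).hasFDerivAt).fderiv

variable [RiemannianBundle (fun p : M₂ => TangentSpace (𝓡 d) p)]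

theorem IsC1Along.dchart_covDerivIn (hξ : IsC1Along f ξ)
    (hx : x ∈ IsManifold.maximalAtlas (𝓡 d) ∞ M₁) (hy : y ∈ IsManifold.maximalAtlas (𝓡 d) ∞ M₂)
    (hu : u ∈ coordDomain f x y) (a : Coord d) :
    dchart y (f (x.symm u)) (covDerivIn y f ξ (x.symm u) (dsymm x u a)) =
      fderiv ℝ (fieldRep f x y ξ) u a + christoffelVec (gram y) (coordRep f x y u)
        (fderiv ℝ (coordRep f x y) u a) (fieldRep f x y ξ u) := by
  ext β
  simp only [covDerivIn, LinearMap.sum_apply, LinearMap.smulRight_apply, map_sum, map_smul,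
    dchart_frame hy hu.2, LinearMap.add_apply, LinearMap.smul_apply, LinearMap.comp_apply,
    ContinuousLinearMap.coe_coe, comp_eq_dchart, hξ.mvfderiv_dchart_dsymm hx hy hu,
    dchart_mfderiv_dsymm ((hξ.contMDiff _).mdifferentiableAt one_ne_zero) hx hy hu,
    WithLp.ofLp_sum, WithLp.ofLp_smul, Finset.sum_apply, Pi.smul_apply,
    stdVec_apply, smul_eq_mul, mul_ite, mul_one, mul_zero, Finset.sum_ite_eq, Finset.mem_univ,
    if_true, christoffelVec, WithLp.ofLp_add, Pi.add_apply, mul_assoc]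
  congr 1
  exact Finset.sum_congr rfl fun γ _ => Finset.sum_congr rfl fun δ _ =>
    congrArg (christoffelOf (gram y) β γ δ (coordRep f x y u) * ·) (mul_comm _ _)

variable [IsContMDiffRiemannianBundle (𝓡 d) ∞ (Coord d) (fun p : M₂ => TangentSpace (𝓡 d) p)]

theorem IsC1Along.dchart_covDerivIn_transition (hξ : IsC1Along f ξ)
    (hx : x ∈ IsManifold.maximalAtlas (𝓡 d) ∞ M₁) (hy : y ∈ IsManifold.maximalAtlas (𝓡 d) ∞ M₂)
    (hy' : y' ∈ IsManifold.maximalAtlas (𝓡 d) ∞ M₂) (hu : u ∈ coordDomain f x y)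
    (hu' : u ∈ coordDomain f x y') (a : Coord d) :
    dchart y' (f (x.symm u)) (covDerivIn y' f ξ (x.symm u) (dsymm x u a)) =
      dchart y' (f (x.symm u)) (covDerivIn y f ξ (x.symm u) (dsymm x u a)) := by
  rw [dchart_eq_fderiv_transition hy hy' hu.2 hu'.2 (covDerivIn y f ξ _ _),
    hξ.dchart_covDerivIn hx hy hu, hξ.dchart_covDerivIn hx hy' hu', map_add]
  change _ = _ + fderiv ℝ (y' ∘ y.symm) (coordRep f x y u) _
  rw [fderiv_transition_christoffelVec hy hy' (coordRep_mem_target hu)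
      (symm_coordRep_mem_source hu hu'), hξ.fderiv_fieldRep_transition hx hy hy' hu hu',
    hξ.fderiv_coordRep_transition hx hy hy' hu hu', fieldRep_eq_fderiv_transition hy hy' hu hu',
    (coordRep_eventuallyEq_transition hξ.contMDiff.continuous hu y').self_of_nhds, add_assoc]
  rfl

theorem IsC1Along.covDerivIn_eq_covDerivIn [IsManifold (𝓡 d) ∞ M₁] (hξ : IsC1Along f ξ)
    (hy : y ∈ IsManifold.maximalAtlas (𝓡 d) ∞ M₂) (hy' : y' ∈ IsManifold.maximalAtlas (𝓡 d) ∞ M₂)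
    {p : M₁} (hp : f p ∈ y.source) (hp' : f p ∈ y'.source) :
    covDerivIn y' f ξ p = covDerivIn y f ξ p := by
  have hx : chartAt (Coord d) p ∈ IsManifold.maximalAtlas (𝓡 d) ∞ M₁ :=
    IsManifold.chart_mem_maximalAtlas p
  obtain ⟨u, hu, hpu⟩ : ∃ u ∈ (chartAt (Coord d) p).target, (chartAt (Coord d) p).symm u = p :=
    ⟨_, mem_chart_target _ p, (chartAt (Coord d) p).left_inv (mem_chart_source _ p)⟩
  generalize chartAt (Coord d) p = x at *
  subst hpu
  refine LinearMap.ext fun z => dchart_injective hy' hp' ?_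
  rw [← dsymm_dchart hx hu z]
  exact hξ.dchart_covDerivIn_transition hx hy hy' ⟨hu, hp⟩ ⟨hu, hp'⟩ _

end Maps

section Divergence

variable {d : ℕ} {F : Coord d → Coord d} {φ ψ ρ : Coord d → ℝ} {u : Coord d}

theorem pd_mul (hφ : DifferentiableAt ℝ φ u) (hψ : DifferentiableAt ℝ ψ u) (j : Fin d) :
    pd j (fun w => φ w * ψ w) u = pd j φ u * ψ u + φ u * pd j ψ u := by
  rw [pd, (hφ.hasFDerivAt.fun_mul hψ.hasFDerivAt).fderiv, add_apply, smul_apply, smul_apply,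
    smul_eq_mul, smul_eq_mul, mul_comm (ψ u), add_comm]
  rfl

theorem pd_comp (hρ : DifferentiableAt ℝ ρ (F u)) (hF : DifferentiableAt ℝ F u) (j : Fin d) :
    pd j (fun w => ρ (F w)) u = ∑ β, jacobian F u β j * pd β ρ (F u) := by
  have hchain : pd j (fun w => ρ (F w)) u = fderiv ℝ ρ (F u) (fderiv ℝ F u (stdVec j)) :=
    congrArg (· (stdVec j)) (fderiv_comp u hρ hF)
  rw [hchain, fderiv_eq_sum_pd]
  refine Finset.sum_congr rfl fun β _ => ?_
  rw [← fderiv_component hF]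
  rfl

theorem sum_adjugate_jacobian_mul_pd_comp (hρ : DifferentiableAt ℝ ρ (F u))
    (hF : DifferentiableAt ℝ F u) (γ : Fin d) :
    ∑ j, (jacobian F u).adjugate j γ * pd j (fun w => ρ (F w)) u =
      (jacobian F u).det * pd γ ρ (F u) :=
  calc ∑ j, (jacobian F u).adjugate j γ * pd j (fun w => ρ (F w)) u
    _ = ∑ β, (jacobian F u * (jacobian F u).adjugate) β γ * pd β ρ (F u) := by
      simp only [pd_comp hρ hF, Matrix.mul_apply, Finset.mul_sum, Finset.sum_mul]
      rw [Finset.sum_comm]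
      exact Finset.sum_congr rfl fun β _ => Finset.sum_congr rfl fun j _ => by ring
    _ = (jacobian F u).det * pd γ ρ (F u) := by
      simp [Matrix.mul_adjugate, Matrix.one_apply]

theorem sum_pd_adjugate_jacobian_mul_comp (hF : ContDiffAt ℝ 2 F u)
    (hρ : DifferentiableAt ℝ ρ (F u)) (γ : Fin d) :
    ∑ j, pd j (fun w => (jacobian F w).adjugate j γ * ρ (F w)) u =
      (∑ j, pd j (fun w => (jacobian F w).adjugate j γ) u) * ρ (F u) +
        (jacobian F u).det * pd γ ρ (F u) := by
  have hadj (j : Fin d) : DifferentiableAt ℝ (fun w => (jacobian F w).adjugate j γ) u :=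
    (contDiffAt_adjugate (contDiffAt_jacobian (m := 1) hF (by norm_num)) j γ).differentiableAt
      one_ne_zero
  have hFd : DifferentiableAt ℝ F u := hF.differentiableAt two_ne_zero
  rw [← sum_adjugate_jacobian_mul_pd_comp hρ hFd, Finset.sum_mul, ← Finset.sum_add_distrib]
  exact Finset.sum_congr rfl fun j _ => pd_mul (hadj j) (hρ.comp u hFd) j

end Divergence

section Pointwise

variable {d : ℕ} {M₁ M₂ : Type*} [TopologicalSpace M₁] [TopologicalSpace M₂]
  [ChartedSpace (Coord d) M₂] [RiemannianBundle (fun p : M₂ => TangentSpace (𝓡 d) p)]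
  {f : M₁ → M₂} {x : OpenPartialHomeomorph M₁ (Coord d)} {y : OpenPartialHomeomorph M₂ (Coord d)}
  {u : Coord d}

theorem pullDensity_pos (hy : y ∈ IsManifold.maximalAtlas (𝓡 d) ∞ M₂)
    (hu : u ∈ coordDomain f x y) : 0 < pullDensity f x y u :=
  density_pos hy (coordRep_mem_target hu)

/-- The matrix `(f^*Γ^α_{βδ}) ξ^δ` (row `α`, column `β`) of connection coefficients along `f`. -/
def connectionMatrix (f : M₁ → M₂) (x : OpenPartialHomeomorph M₁ (Coord d))
    (y : OpenPartialHomeomorph M₂ (Coord d)) (ξ : ∀ p, TangentSpace (𝓡 d) (f p)) (u : Coord d) :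
    Matrix (Fin d) (Fin d) ℝ :=
  Matrix.of fun α β => ∑ δ, christoffel y α β δ (coordRep f x y u) * fieldRep f x y ξ u δ

variable {ξ : ∀ p, TangentSpace (𝓡 d) (f p)}

theorem trace_connectionMatrix : (connectionMatrix f x y ξ u).trace =
    ∑ γ, pullTraceChristoffel f x y γ u * fieldRep f x y ξ u γ := by
  simp only [Matrix.trace, Matrix.diag_apply, connectionMatrix, Matrix.of_apply,
    pullTraceChristoffel, Finset.sum_mul]
  exact Finset.sum_comm

variable [ChartedSpace (Coord d) M₁] [IsManifold (𝓡 d) ∞ M₂]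

theorem toMatrix_covDerivIn (hξ : IsC1Along f ξ) (hx : x ∈ IsManifold.maximalAtlas (𝓡 d) ∞ M₁)
    (hy : y ∈ IsManifold.maximalAtlas (𝓡 d) ∞ M₂) (hu : u ∈ coordDomain f x y) :
    LinearMap.toMatrix (frameBasis hx (x.map_target hu.1)) (frameBasis hy hu.2)
      (covDerivIn y f ξ (x.symm u)) =
      jacobian (fieldRep f x y ξ) u + connectionMatrix f x y ξ u * jac f x y u := by
  have hfield := (hξ.contDiffAt_fieldRep hx hy hu).differentiableAt one_ne_zero
  ext α i
  rw [LinearMap.toMatrix_apply, frameBasis_repr, coe_frameBasis, ← dsymm_stdVec hx hu.1,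
    hξ.dchart_covDerivIn hx hy hu, WithLp.ofLp_add, Pi.add_apply, ← fderiv_component hfield]
  simp only [christoffelVec, ← fderiv_component (hξ.differentiableAt_coordRep hx hy hu),
    Matrix.add_apply, Matrix.mul_apply, connectionMatrix, Matrix.of_apply, Finset.sum_mul]
  exact congrArg _ (Finset.sum_congr rfl fun β _ => Finset.sum_congr rfl fun δ _ => by
    rw [mul_comm (fderiv _ _ _ _), ← mul_assoc]
    rfl)

variable [IsContMDiffRiemannianBundle (𝓡 d) ∞ (Coord d) (fun p : M₂ => TangentSpace (𝓡 d) p)]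

theorem contDiffAt_pullDensity {n : WithTop ℕ∞} (hn : n ≤ ∞)
    (hf : ContMDiffAt (𝓡 d) (𝓡 d) n f (x.symm u)) (hx : x ∈ IsManifold.maximalAtlas (𝓡 d) ∞ M₁)
    (hy : y ∈ IsManifold.maximalAtlas (𝓡 d) ∞ M₂) (hu : u ∈ coordDomain f x y) :
    ContDiffAt ℝ n (pullDensity f x y) u :=
  ((contDiffAt_density hy (coordRep_mem_target hu)).of_le hn).comp u
    (contDiffAt_coordRep hn hf hx hy hu)

theorem divDensityCof_eq_add (hf : ContMDiff (𝓡 d) (𝓡 d) 2 f)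
    (hx : x ∈ IsManifold.maximalAtlas (𝓡 d) ∞ M₁) (hy : y ∈ IsManifold.maximalAtlas (𝓡 d) ∞ M₂)
    (hu : u ∈ coordDomain f x y) (γ : Fin d) :
    divDensityCof f x y γ u = divCof f x y γ u * pullDensity f x y u +
      pullDensity f x y u * (pullTraceChristoffel f x y γ u * (jac f x y u).det) := by
  have hv := coordRep_mem_target hu
  refine (sum_pd_adjugate_jacobian_mul_comp (contDiffAt_coordRep (by norm_cast) (hf _) hx hy hu)
    ((contDiffAt_density hy hv).differentiableAt (by simp)) γ).trans ?_
  rw [pd_density hy hv, mul_comm (Matrix.det _), mul_assoc]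
  rfl

theorem coordPiola_eq_neg_divCof (hf : ContMDiff (𝓡 d) (𝓡 d) 2 f)
    (hx : x ∈ IsManifold.maximalAtlas (𝓡 d) ∞ M₁) (hy : y ∈ IsManifold.maximalAtlas (𝓡 d) ∞ M₂)
    (hu : u ∈ coordDomain f x y) (γ : Fin d) : coordPiola f x y γ u = -divCof f x y γ u := by
  have hpos := (pullDensity_pos hy hu).ne'
  rw [coordPiola, divDensityCof_eq_add hf hx hy hu]
  field_simp
  ring

theorem divDensityCof_eq (hf : ContMDiff (𝓡 d) (𝓡 d) 2 f)
    (hx : x ∈ IsManifold.maximalAtlas (𝓡 d) ∞ M₁) (hy : y ∈ IsManifold.maximalAtlas (𝓡 d) ∞ M₂)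
    (hu : u ∈ coordDomain f x y) (γ : Fin d) :
    divDensityCof f x y γ u =
      pullDensity f x y u * (pullTraceChristoffel f x y γ u * (jac f x y u).det) := by
  rw [divDensityCof_eq_add hf hx hy hu, divCof_eq_zero hf hx hy hu, zero_mul, zero_add]

theorem divDensityCof_eq_zero_iff (hf : ContMDiff (𝓡 d) (𝓡 d) 2 f)
    (hx : x ∈ IsManifold.maximalAtlas (𝓡 d) ∞ M₁) (hy : y ∈ IsManifold.maximalAtlas (𝓡 d) ∞ M₂)
    (hu : u ∈ coordDomain f x y) (γ : Fin d) :
    divDensityCof f x y γ u = 0 ↔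
      pullTraceChristoffel f x y γ u = 0 ∨ (jac f x y u).det = 0 := by
  rw [divDensityCof_eq hf hx hy hu, mul_eq_zero, mul_eq_zero,
    or_iff_right (pullDensity_pos hy hu).ne']

variable [IsManifold (𝓡 d) ∞ M₁] [RiemannianBundle (fun p : M₁ => TangentSpace (𝓡 d) p)]
  [NeZero d] {o₁ : ManifoldOrientation d M₁} {o₂ : ManifoldOrientation d M₂}

theorem homInner_cofDiff_covDeriv (hx : x ∈ IsManifold.maximalAtlas (𝓡 d) ∞ M₁)
    (hy : y ∈ IsManifold.maximalAtlas (𝓡 d) ∞ M₂) (hxpos : IsPositiveChart o₁.orient x)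
    (hypos : IsPositiveChart o₂.orient y) (hξ : IsC1Along f ξ) (hu : u ∈ coordDomain f x y) :
    homInner (cofDiff o₁ o₂ f (x.symm u)) (covDeriv f ξ (x.symm u)) * density x u =
      (((jac f x y u).adjugate * jacobian (fieldRep f x y ξ) u).trace +
        (jac f x y u).det * (connectionMatrix f x y ξ u).trace) * pullDensity f x y u := by
  have hp := x.map_target hu.1
  have hcov : covDeriv f ξ (x.symm u) = covDerivIn y f ξ (x.symm u) :=
    hξ.covDerivIn_eq_covDerivIn hy (IsManifold.chart_mem_maximalAtlas _) hu.2
      (mem_chart_source _ _)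
  have hx_density := volumeForm_frame_of_isPositiveChart hxpos hu.1
  have hy_density : (o₂.orient (f (x.symm u))).volumeForm (frame y (f (x.symm u))) =
      pullDensity f x y u := by
    have h := volumeForm_frame_of_isPositiveChart hypos (coordRep_mem_target hu)
    rwa [coordRep, y.left_inv hu.2] at h
  have hconnection := trace_adjugate_mul_mul 1 (connectionMatrix f x y ξ u) (jac f x y u)
  rw [Matrix.adjugate_one, one_mul, one_mul] at hconnection
  rw [← hx_density, ← hy_density, ← coe_frameBasis hx hp, ← coe_frameBasis hy hu.2, cofDiff,
    homInner_Cof_mul_volumeForm _ _ (frameBasis hx hp) (frameBasis hy hu.2), hcov,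
    toMatrix_mfderiv (hξ.contMDiff _) hx hy hu, toMatrix_covDerivIn hξ hx hy hu, mul_add,
    Matrix.trace_add, hconnection]

theorem homInner_cofDiff_covDeriv_eq_sum (hx : x ∈ IsManifold.maximalAtlas (𝓡 d) ∞ M₁)
    (hy : y ∈ IsManifold.maximalAtlas (𝓡 d) ∞ M₂) (hxpos : IsPositiveChart o₁.orient x)
    (hypos : IsPositiveChart o₂.orient y) (hξ : IsC1Along f ξ) (hu : u ∈ coordDomain f x y) :
    homInner (cofDiff o₁ o₂ f (x.symm u)) (covDeriv f ξ (x.symm u)) * density x u =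
      ∑ γ, ((∑ j, (matCof (jac f x y u))ᵀ j γ * pd j (fun w => fieldRep f x y ξ w γ) u) +
        pullTraceChristoffel f x y γ u * (jac f x y u).det * fieldRep f x y ξ u γ) *
          pullDensity f x y u := by
  rw [homInner_cofDiff_covDeriv hx hy hxpos hypos hξ hu, trace_connectionMatrix,
    ← Finset.sum_mul, Finset.sum_add_distrib, Finset.mul_sum]
  congr 2
  · simp only [Matrix.trace, Matrix.diag_apply, Matrix.mul_apply]
    exact Finset.sum_comm
  · exact Finset.sum_congr rfl fun γ _ => by ring

end Pointwise

section Volume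

open MeasureTheory

theorem measurableSet_inter_preimage_of_continuousOn {X Y : Type*} [TopologicalSpace X]
    [MeasurableSpace X] [OpensMeasurableSpace X] [TopologicalSpace Y] [MeasurableSpace Y]
    [BorelSpace Y] {g : X → Y} {T : Set X} (hT : MeasurableSet T) (hg : ContinuousOn g T)
    {s : Set Y} (hs : MeasurableSet s) : MeasurableSet (T ∩ g ⁻¹' s) := by
  rw [← Subtype.image_preimage_coe]
  exact hT.subtype_image (hg.domRestrict.measurable hs)

variable {d : ℕ}

theorem det_fderiv_eq_det_jacobian {F : Coord d → Coord d} {u : Coord d}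
    (hF : DifferentiableAt ℝ F u) : (fderiv ℝ F u).det = (jacobian F u).det := by
  have hmatrix : LinearMap.toMatrix (EuclideanSpace.basisFun (Fin d) ℝ).toBasis
      (EuclideanSpace.basisFun (Fin d) ℝ).toBasis (fderiv ℝ F u).toLinearMap = jacobian F u := by
    ext α i
    simp [LinearMap.toMatrix_apply, jacobian, pd, fderiv_component hF, stdVec]
  rw [← hmatrix, LinearMap.det_toMatrix]

variable {M : Type*} [TopologicalSpace M] {x y : OpenPartialHomeomorph M (Coord d)} {s : Set M}

theorem image_transition_eq_of_subset (hsx : s ⊆ x.source) (hsy : s ⊆ y.source) :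
    (x ∘ y.symm) '' (y.target ∩ y.symm ⁻¹' s) = x.target ∩ x.symm ⁻¹' s := by
  rw [Set.image_comp, ← y.image_eq_target_inter_inv_preimage hsy,
    ← x.image_eq_target_inter_inv_preimage hsx]
  exact congrArg (x '' ·) (y.toPartialEquiv.symm_image_image_of_subset_source hsy)

theorem aemeasurable_symm [MeasurableSpace M] [BorelSpace M]
    (x : OpenPartialHomeomorph M (Coord d)) (φ : Coord d → ENNReal) :
    AEMeasurable x.symm (((volume : Measure (Coord d)).restrict x.target).withDensity φ) :=
  (x.continuousOn_symm.aemeasurable x.open_target.measurableSet).mono_ac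
    (withDensity_absolutelyContinuous _ _)

variable [ChartedSpace (Coord d) M] [RiemannianBundle (fun p : M => TangentSpace (𝓡 d) p)]

theorem gram_transition (hx : x ∈ IsManifold.maximalAtlas (𝓡 d) ∞ M)
    (hy : y ∈ IsManifold.maximalAtlas (𝓡 d) ∞ M) {v : Coord d} (hv : v ∈ y.target)
    (hv' : y.symm v ∈ x.source) :
    gram y v = (jacobian (x ∘ y.symm) v)ᵀ * gram x ((x ∘ y.symm) v) *
      jacobian (x ∘ y.symm) v := by
  have hdiff : DifferentiableAt ℝ (x ∘ y.symm) v :=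
    (contDiffAt_transition hy hx hv hv').differentiableAt (by simp)
  ext α β
  rw [← bil_stdVec (gram y v), ← bil_gram_transition hy hx hv hv', bil_eq_dotProduct,
    Matrix.mul_assoc, Matrix.mul_apply]
  simp only [dotProduct, Matrix.transpose_apply, Matrix.mulVec, Matrix.mul_apply,
    ← fderiv_component hdiff]
  rfl

theorem density_transition (hx : x ∈ IsManifold.maximalAtlas (𝓡 d) ∞ M)
    (hy : y ∈ IsManifold.maximalAtlas (𝓡 d) ∞ M) {v : Coord d} (hv : v ∈ y.target)
    (hv' : y.symm v ∈ x.source) :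
    density y v = |(fderiv ℝ (x ∘ y.symm) v).det| * density x ((x ∘ y.symm) v) := by
  rw [density, gram_transition hx hy hv hv', Matrix.det_mul, Matrix.det_mul,
    Matrix.det_transpose, mul_right_comm, ← sq, Real.sqrt_mul (sq_nonneg _), Real.sqrt_sq_eq_abs,
    det_fderiv_eq_det_jacobian
      ((contDiffAt_transition hy hx hv hv').differentiableAt (by simp))]
  rfl

variable [MeasurableSpace M]

theorem chartVolume_le_riemVolume (hx : x ∈ IsManifold.maximalAtlas (𝓡 d) ∞ M) :
    chartVolume x ≤ riemVolume d M :=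
  le_iSup₂ (f := fun y (_ : y ∈ IsManifold.maximalAtlas (𝓡 d) ∞ M) => chartVolume y) x hx

variable [BorelSpace M]

theorem chartVolume_apply (x : OpenPartialHomeomorph M (Coord d)) (hs : MeasurableSet s) :
    chartVolume x s = ∫⁻ u in x.target ∩ x.symm ⁻¹' s, ENNReal.ofReal (density x u) := by
  rw [chartVolume, Measure.map_apply_of_aemeasurable (aemeasurable_symm x _) hs,
    withDensity_apply', Measure.restrict_restrict' x.open_target.measurableSet, Set.inter_comm]

theorem chartVolume_compl_source (x : OpenPartialHomeomorph M (Coord d)) :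
    chartVolume x x.sourceᶜ = 0 := by
  have hempty : x.target ∩ x.symm ⁻¹' x.sourceᶜ = ∅ :=
    Set.eq_empty_of_forall_notMem fun _ hu => hu.2 (x.map_target hu.1)
  rw [chartVolume_apply x x.open_source.measurableSet.compl, hempty, setLIntegral_empty]

theorem chartVolume_restrict_source (x : OpenPartialHomeomorph M (Coord d)) :
    (chartVolume x).restrict x.source = chartVolume x :=
  Measure.restrict_eq_self_of_ae_mem (chartVolume_compl_source x)

theorem chartVolume_apply_eq (hx : x ∈ IsManifold.maximalAtlas (𝓡 d) ∞ M)
    (hy : y ∈ IsManifold.maximalAtlas (𝓡 d) ∞ M) (hs : MeasurableSet s) (hsx : s ⊆ x.source)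
    (hsy : s ⊆ y.source) : chartVolume y s = chartVolume x s := by
  have hmeas : MeasurableSet (y.target ∩ y.symm ⁻¹' s) :=
    measurableSet_inter_preimage_of_continuousOn y.open_target.measurableSet y.continuousOn_symm hs
  have hinj : Set.InjOn (x ∘ y.symm) (y.target ∩ y.symm ⁻¹' s) := fun v hv w hw hvw =>
    y.symm.injOn hv.1 hw.1 (x.injOn (hsx hv.2) (hsx hw.2) hvw)
  have hder (v : Coord d) (hv : v ∈ y.target ∩ y.symm ⁻¹' s) :
      HasFDerivWithinAt (x ∘ y.symm) (fderiv ℝ (x ∘ y.symm) v) (y.target ∩ y.symm ⁻¹' s) v :=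
    ((contDiffAt_transition hy hx hv.1 (hsx hv.2)).differentiableAt
      (by simp)).hasFDerivAt.hasFDerivWithinAt
  rw [chartVolume_apply y hs, chartVolume_apply x hs, ← image_transition_eq_of_subset hsx hsy,
    lintegral_image_eq_lintegral_abs_det_fderiv_mul volume hmeas hder hinj]
  refine setLIntegral_congr_fun hmeas fun v hv => ?_
  rw [← ENNReal.ofReal_mul (abs_nonneg _), density_transition hx hy hv.1 (hsx hv.2)]

theorem chartVolume_restrict_le (hx : x ∈ IsManifold.maximalAtlas (𝓡 d) ∞ M)
    (hy : y ∈ IsManifold.maximalAtlas (𝓡 d) ∞ M) :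
    (chartVolume y).restrict x.source ≤ chartVolume x := by
  refine Measure.le_iff.2 fun s hs => ?_
  have hsx := hs.inter x.open_source.measurableSet
  calc (chartVolume y).restrict x.source s
      = (chartVolume y).restrict y.source (s ∩ x.source) := by
        rw [Measure.restrict_apply hs, chartVolume_restrict_source]
    _ = chartVolume y (s ∩ x.source ∩ y.source) := Measure.restrict_apply hsx
    _ = chartVolume x (s ∩ x.source ∩ y.source) :=
        chartVolume_apply_eq hx hy (hsx.inter y.open_source.measurableSet) (fun _ h => h.1.2)
          fun _ h => h.2
    _ ≤ chartVolume x s := measure_mono fun _ h => h.1.1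

theorem riemVolume_restrict_source (hx : x ∈ IsManifold.maximalAtlas (𝓡 d) ∞ M) :
    (riemVolume d M).restrict x.source = chartVolume x := by
  have hmeas := x.open_source.measurableSet
  have hle : riemVolume d M ≤ chartVolume x + (riemVolume d M).restrict x.sourceᶜ := by
    refine iSup₂_le fun y hy => ?_
    rw [← Measure.restrict_add_restrict_compl (μ := chartVolume y) hmeas]
    exact add_le_add (chartVolume_restrict_le hx hy)
      (Measure.restrict_mono le_rfl (chartVolume_le_riemVolume hy))
  apply le_antisymm
  · refine (Measure.restrict_mono le_rfl hle).trans ?_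
    rw [Measure.restrict_add, Measure.restrict_restrict hmeas, Set.inter_compl_self,
      Measure.restrict_empty, add_zero, chartVolume_restrict_source]
  · rw [← chartVolume_restrict_source x]
    exact Measure.restrict_mono le_rfl (chartVolume_le_riemVolume hx)

variable [IsManifold (𝓡 d) ∞ M]
  [IsContMDiffRiemannianBundle (𝓡 d) ∞ (Coord d) (fun p : M => TangentSpace (𝓡 d) p)]

variable {g : M → ℝ}

theorem integrableOn_source_iff (hx : x ∈ IsManifold.maximalAtlas (𝓡 d) ∞ M)
    (hg : ContinuousOn g x.source) :
    IntegrableOn g x.source (riemVolume d M) ↔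
      IntegrableOn (fun u => g (x.symm u) * density x u) x.target := by
  have hmeas : AEStronglyMeasurable g (chartVolume x) :=
    chartVolume_restrict_source x ▸ hg.aestronglyMeasurable x.open_source.measurableSet
  rw [IntegrableOn, riemVolume_restrict_source hx]
  rw [chartVolume] at hmeas ⊢
  rw [integrable_map_measure hmeas (aemeasurable_symm x _),
    integrable_withDensity_iff_integrable_smul₀' (((continuousOn_density hx).aemeasurable
      x.open_target.measurableSet).ennreal_ofReal) (by simp)]
  refine integrableOn_congr_fun (fun u hu => ?_) x.open_target.measurableSet
  rw [ENNReal.toReal_ofReal (density_pos hx hu).le, smul_eq_mul, mul_comm, Function.comp_apply]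

theorem setIntegral_source (hx : x ∈ IsManifold.maximalAtlas (𝓡 d) ∞ M)
    (hg : ContinuousOn g x.source) :
    ∫ p in x.source, g p ∂(riemVolume d M) = ∫ u in x.target, g (x.symm u) * density x u := by
  have hmeas : AEStronglyMeasurable g (chartVolume x) :=
    chartVolume_restrict_source x ▸ hg.aestronglyMeasurable x.open_source.measurableSet
  rw [riemVolume_restrict_source hx]
  rw [chartVolume] at hmeas ⊢
  rw [integral_map (aemeasurable_symm x _) hmeas,
    integral_withDensity_eq_integral_toReal_smul₀ (((continuousOn_density hx).aemeasurable
      x.open_target.measurableSet).ennreal_ofReal) (by simp)]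
  refine setIntegral_congr_fun x.open_target.measurableSet fun u hu => ?_
  simp only [ENNReal.toReal_ofReal (density_pos hx hu).le, smul_eq_mul, mul_comm]

end Volume

section Divergence

open MeasureTheory

variable {d : ℕ}

theorem continuous_pd {φ : Coord d → ℝ} (hφ : ContDiff ℝ 1 φ) (j : Fin d) :
    Continuous (pd j φ) :=
  (hφ.continuous_fderiv one_ne_zero).clm_apply continuous_const

theorem integrable_pd {φ : Coord d → ℝ} (hφ : ContDiff ℝ 1 φ) (hc : HasCompactSupport φ)
    (j : Fin d) : Integrable (pd j φ) :=
  (continuous_pd hφ j).integrable_of_hasCompactSupport (hc.fderiv_apply ℝ (stdVec j))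

theorem integral_pd_eq_zero {φ : Coord d → ℝ} (hφ : ContDiff ℝ 1 φ) (hc : HasCompactSupport φ)
    (j : Fin d) : ∫ u, pd j φ u = 0 := by
  have hparts := integral_mul_fderiv_eq_neg_fderiv_mul_of_integrable
    (μ := (volume : Measure (Coord d))) (f := φ) (g := fun _ => (1 : ℝ)) (v := stdVec j)
    (by simp only [mul_one]; exact integrable_pd hφ hc j) (by simp)
    (by simpa only [mul_one] using hφ.continuous.integrable_of_hasCompactSupport hc)
    (fun z _ => hφ.differentiable one_ne_zero z) (fun _ _ => by simp)
  simpa [pd] using hparts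

theorem integral_sum_pd_eq_zero {V : Fin d → Coord d → ℝ} (hV : ∀ j, ContDiff ℝ 1 (V j))
    (hc : ∀ j, HasCompactSupport (V j)) : ∫ u, ∑ j, pd j (V j) u = 0 := by
  rw [integral_finsetSum _ fun j _ => integrable_pd (hV j) (hc j) j]
  exact Finset.sum_eq_zero fun j _ => integral_pd_eq_zero (hV j) (hc j) j

end Divergence

section Support

variable {d : ℕ} {M₁ M₂ : Type*} [TopologicalSpace M₁] [TopologicalSpace M₂]
  [ChartedSpace (Coord d) M₂] {f : M₁ → M₂}

/-- The support of a vector field along `f`: the closure of the set where it does not vanish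
(`tsupport` does not apply, since the values lie in varying tangent spaces). -/
def fieldSupport (ξ : ∀ p, TangentSpace (𝓡 d) (f p)) : Set M₁ :=
  closure {p | ξ p ≠ 0}

variable {ξ : ∀ p, TangentSpace (𝓡 d) (f p)} {p : M₁}

theorem eq_zero_of_notMem_fieldSupport (hp : p ∉ fieldSupport ξ) : ξ p = 0 :=
  not_not.1 fun h => hp (subset_closure h)

theorem eventually_eq_zero_of_notMem_fieldSupport (hp : p ∉ fieldSupport ξ) :
    ∀ᶠ q in nhds p, ξ q = 0 :=
  Filter.mem_of_superset (isClosed_closure.isOpen_compl.mem_nhds hp) fun _ =>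
    eq_zero_of_notMem_fieldSupport

theorem fieldSupport_smul_subset (φ : M₁ → ℝ) (ξ : ∀ p, TangentSpace (𝓡 d) (f p)) :
    fieldSupport (fun p => φ p • ξ p) ⊆ fieldSupport ξ ∩ tsupport φ :=
  Set.subset_inter (closure_mono fun _ => right_ne_zero_of_smul)
    (closure_mono fun _ => left_ne_zero_of_smul)

theorem isCompact_image_fieldSupport {x : OpenPartialHomeomorph M₁ (Coord d)}
    (hK : IsCompact (fieldSupport ξ)) (hsub : fieldSupport ξ ⊆ x.source) :
    IsCompact (x '' fieldSupport ξ) :=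
  hK.image_of_continuousOn (x.continuousOn.mono hsub)

end Support

section CovariantDerivative

variable {d : ℕ} {M₁ M₂ : Type*} [TopologicalSpace M₁] [ChartedSpace (Coord d) M₁]
  [TopologicalSpace M₂] [ChartedSpace (Coord d) M₂] {f : M₁ → M₂}

theorem mvfderiv_fun_sum {𝕜 E H E' M : Type*} [NontriviallyNormedField 𝕜] [NormedAddCommGroup E]
    [NormedSpace 𝕜 E] [TopologicalSpace H] {I : ModelWithCorners 𝕜 E H} [NormedAddCommGroup E']
    [NormedSpace 𝕜 E'] [TopologicalSpace M] [ChartedSpace H M] {ι : Type*} (s : Finset ι)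
    {g : ι → M → E'} {p : M} (hg : ∀ i, MDifferentiableAt I 𝓘(𝕜, E') (g i) p) :
    MDifferentiableAt I 𝓘(𝕜, E') (fun q => ∑ i ∈ s, g i q) p ∧
      mvfderiv I (fun q => ∑ i ∈ s, g i q) p = ∑ i ∈ s, mvfderiv I (g i) p := by
  classical
  induction s using Finset.induction_on with
  | empty =>
    simp only [Finset.sum_empty]
    exact ⟨mdifferentiableAt_const, mvfderiv_const 0⟩
  | insert i s hi ih =>
    simp only [Finset.sum_insert hi]
    exact ⟨(hg i).add ih.1, by rw [mvfderiv_fun_add (hg i) ih.1, ih.2]⟩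

section Smooth

variable [IsManifold (𝓡 d) ∞ M₂]

theorem IsC1Along.smul {ξ : ∀ p, TangentSpace (𝓡 d) (f p)} (hξ : IsC1Along f ξ) {φ : M₁ → ℝ}
    (hφ : ContMDiff (𝓡 d) 𝓘(ℝ, ℝ) 1 φ) : IsC1Along f (fun p => φ p • ξ p) := by
  intro p
  obtain ⟨hbase, hfiber⟩ := Bundle.contMDiffAt_totalSpace.1 (hξ p)
  refine Bundle.contMDiffAt_totalSpace.2 ⟨hbase, ((hφ p).smul hfiber).congr_of_eventuallyEq ?_⟩
  set e := trivializationAt (Coord d) (TangentSpace (𝓡 d) : M₂ → Type _) (f p)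
  have hmem : ∀ᶠ q in nhds p, f q ∈ e.baseSet :=
    hbase.continuousAt.preimage_mem_nhds
      (e.open_baseSet.mem_nhds (mem_baseSet_trivializationAt (Coord d) _ (f p)))
  filter_upwards [hmem] with q hq
  exact (e.linear ℝ hq).2 _ _

end Smooth

variable [RiemannianBundle (fun p : M₂ => TangentSpace (𝓡 d) p)]

theorem covDeriv_sum [IsManifold (𝓡 d) ∞ M₂] {ι : Type*} (s : Finset ι)
    {ξ : ι → ∀ p, TangentSpace (𝓡 d) (f p)} (hξ : ∀ i, IsC1Along f (ξ i)) (p : M₁) :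
    covDeriv f (fun q => ∑ i ∈ s, ξ i q) p = ∑ i ∈ s, covDeriv f (ξ i) p := by
  have hy : chartAt (Coord d) (f p) ∈ IsManifold.maximalAtlas (𝓡 d) ∞ M₂ :=
    IsManifold.chart_mem_maximalAtlas _
  have hmvfderiv (β : Fin d) :
      mvfderiv (𝓡 d) (fun q => comp (chartAt (Coord d) (f p)) (f q) β (∑ i ∈ s, ξ i q)) p =
        ∑ i ∈ s, mvfderiv (𝓡 d) (fun q => comp (chartAt (Coord d) (f p)) (f q) β (ξ i q)) p := by
    simp only [map_sum]
    exact (mvfderiv_fun_sum s fun i =>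
      (hξ i).mdifferentiableAt_dchart hy (mem_chart_source _ _) β).2
  refine LinearMap.ext fun v => ?_
  simp only [covDeriv, covDerivIn, hmvfderiv]
  simp only [LinearMap.sum_apply, LinearMap.smulRight_apply, LinearMap.add_apply,
    ContinuousLinearMap.coe_coe, sum_apply, LinearMap.smul_apply, map_sum]
  rw [Finset.sum_comm]
  refine Finset.sum_congr rfl fun β _ => ?_
  rw [← Finset.sum_smul, Finset.sum_add_distrib]
  simp only [Finset.mul_sum, Finset.sum_smul]
  rw [Finset.sum_comm_cycle]

theorem covDeriv_eq_zero {ξ : ∀ p, TangentSpace (𝓡 d) (f p)} {p : M₁}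
    (hp : p ∉ fieldSupport ξ) : covDeriv f ξ p = 0 := by
  have hzero := eventually_eq_zero_of_notMem_fieldSupport hp
  have hmvfderiv (y : OpenPartialHomeomorph M₂ (Coord d)) (β : Fin d) :
      mvfderiv (𝓡 d) (fun q => comp y (f q) β (ξ q)) p = 0 := by
    have hcomp : (fun q => comp y (f q) β (ξ q)) =ᶠ[nhds p] fun _ => (0 : ℝ) := by
      filter_upwards [hzero] with q hq
      rw [hq, map_zero]
    have hconst : HasMFDerivAt (𝓡 d) 𝓘(ℝ, ℝ) (fun q => comp y (f q) β (ξ q)) p 0 :=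
      (hasMFDerivAt_const (0 : ℝ) p).congr_of_eventuallyEq hcomp
    exact hconst.mfderiv
  simp [covDeriv, covDerivIn, hmvfderiv, hzero.self_of_nhds]

end CovariantDerivative

section Flux

variable {d : ℕ} {M₁ M₂ : Type*} [TopologicalSpace M₁] [TopologicalSpace M₂]
  [ChartedSpace (Coord d) M₂] [RiemannianBundle (fun p : M₂ => TangentSpace (𝓡 d) p)]

/-- The components of the vector field `(cof [df]ᵀ)^j_γ |f^*h|^{1/2} ξ^γ` on the coordinate
domain, extended by zero. Its divergence is the integrand of the weak Piola identity. -/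
def fluxRep (f : M₁ → M₂) (x : OpenPartialHomeomorph M₁ (Coord d))
    (y : OpenPartialHomeomorph M₂ (Coord d)) (ξ : ∀ p, TangentSpace (𝓡 d) (f p)) (j : Fin d) :
    Coord d → ℝ :=
  (coordDomain f x y).indicator fun u =>
    ∑ γ, (matCof (jac f x y u))ᵀ j γ * pullDensity f x y u * fieldRep f x y ξ u γ

variable {f : M₁ → M₂} {x : OpenPartialHomeomorph M₁ (Coord d)}
  {y : OpenPartialHomeomorph M₂ (Coord d)} {ξ : ∀ p, TangentSpace (𝓡 d) (f p)} {u : Coord d}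

theorem fluxRep_eventuallyEq (hf : Continuous f) (hu : u ∈ coordDomain f x y) (j : Fin d) :
    fluxRep f x y ξ j =ᶠ[nhds u] fun w =>
      ∑ γ, (matCof (jac f x y w))ᵀ j γ * pullDensity f x y w * fieldRep f x y ξ w γ :=
  Filter.eventuallyEq_of_mem ((isOpen_coordDomain hf x y).mem_nhds hu) fun _ hw =>
    Set.indicator_of_mem hw _

theorem tsupport_fluxRep_subset (hK : IsCompact (fieldSupport ξ))
    (hsub : fieldSupport ξ ⊆ x.source) (j : Fin d) :
    tsupport (fluxRep f x y ξ j) ⊆ x '' fieldSupport ξ := by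
  refine closure_minimal (fun u hu => ?_) (isCompact_image_fieldSupport hK hsub).isClosed
  have hdom : u ∈ coordDomain f x y := Set.mem_of_indicator_ne_zero hu
  refine ⟨x.symm u, subset_closure fun hzero => hu ?_, x.right_inv hdom.1⟩
  simp [fluxRep, fieldRep, hzero]

theorem hasCompactSupport_fluxRep (hK : IsCompact (fieldSupport ξ))
    (hsub : fieldSupport ξ ⊆ x.source) (j : Fin d) : HasCompactSupport (fluxRep f x y ξ j) :=
  (isCompact_image_fieldSupport hK hsub).of_isClosed_subset isClosed_closure
    (tsupport_fluxRep_subset hK hsub j)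

theorem pd_fluxRep_eq_zero (hK : IsCompact (fieldSupport ξ)) (hsub : fieldSupport ξ ⊆ x.source)
    (hu : u ∉ x '' fieldSupport ξ) (j : Fin d) : pd j (fluxRep f x y ξ j) u = 0 := by
  rw [pd, fderiv_of_notMem_tsupport ℝ fun h => hu (tsupport_fluxRep_subset hK hsub j h),
    zero_apply]

variable [ChartedSpace (Coord d) M₁] [IsManifold (𝓡 d) ∞ M₂]
  [IsContMDiffRiemannianBundle (𝓡 d) ∞ (Coord d) (fun p : M₂ => TangentSpace (𝓡 d) p)]

theorem contDiffAt_matCof_mul_pullDensity (hf : ContMDiff (𝓡 d) (𝓡 d) 2 f)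
    (hx : x ∈ IsManifold.maximalAtlas (𝓡 d) ∞ M₁) (hy : y ∈ IsManifold.maximalAtlas (𝓡 d) ∞ M₂)
    (hu : u ∈ coordDomain f x y) (j γ : Fin d) :
    ContDiffAt ℝ 1 (fun w => (matCof (jac f x y w))ᵀ j γ * pullDensity f x y w) u :=
  (contDiffAt_adjugate (contDiffAt_jacobian
      (contDiffAt_coordRep (by norm_cast) (hf _) hx hy hu) (by norm_num)) j γ).mul
    ((contDiffAt_pullDensity (by norm_cast) (hf _) hx hy hu).of_le (by norm_num))

theorem contDiff_fluxRep (hf : ContMDiff (𝓡 d) (𝓡 d) 2 f)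
    (hx : x ∈ IsManifold.maximalAtlas (𝓡 d) ∞ M₁) (hy : y ∈ IsManifold.maximalAtlas (𝓡 d) ∞ M₂)
    (hξ : IsC1Along f ξ) (hK : IsCompact (fieldSupport ξ))
    (hsub : fieldSupport ξ ⊆ x.source ∩ f ⁻¹' y.source) (j : Fin d) :
    ContDiff ℝ 1 (fluxRep f x y ξ j) := by
  refine (contMDiff_of_tsupport fun u hu => ContDiffAt.contMDiffAt ?_).contDiff
  obtain ⟨p, hp, rfl⟩ := tsupport_fluxRep_subset hK (fun _ hp => (hsub hp).1) j hu
  have hdom : x p ∈ coordDomain f x y :=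
    ⟨x.map_source (hsub hp).1, by rw [x.left_inv (hsub hp).1]; exact (hsub hp).2⟩
  exact (ContDiffAt.sum fun γ _ => (contDiffAt_matCof_mul_pullDensity hf hx hy hdom j γ).mul
    (contDiffAt_euclidean.1 (hξ.contDiffAt_fieldRep hx hy hdom) γ)).congr_of_eventuallyEq
      (fluxRep_eventuallyEq hf.continuous hdom j)

theorem pd_fluxRep (hf : ContMDiff (𝓡 d) (𝓡 d) 2 f)
    (hx : x ∈ IsManifold.maximalAtlas (𝓡 d) ∞ M₁) (hy : y ∈ IsManifold.maximalAtlas (𝓡 d) ∞ M₂)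
    (hξ : IsC1Along f ξ) (hu : u ∈ coordDomain f x y) (j : Fin d) :
    pd j (fluxRep f x y ξ j) u =
      ∑ γ, (pd j (fun w => (matCof (jac f x y w))ᵀ j γ * pullDensity f x y w) u *
          fieldRep f x y ξ u γ +
        (matCof (jac f x y u))ᵀ j γ * pullDensity f x y u *
          pd j (fun w => fieldRep f x y ξ w γ) u) := by
  have hcof (γ : Fin d) :=
    (contDiffAt_matCof_mul_pullDensity hf hx hy hu j γ).differentiableAt one_ne_zero
  have hfield (γ : Fin d) :=
    (contDiffAt_euclidean.1 (hξ.contDiffAt_fieldRep hx hy hu) γ).differentiableAt one_ne_zero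
  rw [pd, (fluxRep_eventuallyEq hf.continuous hu j).fderiv_eq,
    fderiv_fun_sum fun γ _ => (hcof γ).fun_mul (hfield γ), sum_apply]
  exact Finset.sum_congr rfl fun γ _ => pd_mul (hcof γ) (hfield γ) j

theorem sum_pd_fluxRep (hf : ContMDiff (𝓡 d) (𝓡 d) 2 f)
    (hx : x ∈ IsManifold.maximalAtlas (𝓡 d) ∞ M₁) (hy : y ∈ IsManifold.maximalAtlas (𝓡 d) ∞ M₂)
    (hξ : IsC1Along f ξ) (hu : u ∈ coordDomain f x y) :
    ∑ j, pd j (fluxRep f x y ξ j) u =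
      ∑ γ, ((∑ j, (matCof (jac f x y u))ᵀ j γ * pd j (fun w => fieldRep f x y ξ w γ) u) +
        pullTraceChristoffel f x y γ u * (jac f x y u).det * fieldRep f x y ξ u γ) *
          pullDensity f x y u := by
  simp only [pd_fluxRep hf hx hy hξ hu]
  rw [Finset.sum_comm]
  refine Finset.sum_congr rfl fun γ _ => ?_
  have hdiv := divDensityCof_eq hf hx hy hu γ
  rw [divDensityCof] at hdiv
  rw [Finset.sum_add_distrib, ← Finset.sum_mul, hdiv, add_mul, Finset.sum_mul, add_comm]
  congr 1
  · exact Finset.sum_congr rfl fun j _ => by ring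
  · ring

variable [IsManifold (𝓡 d) ∞ M₁] [RiemannianBundle (fun p : M₁ => TangentSpace (𝓡 d) p)]
  [NeZero d] {o₁ : ManifoldOrientation d M₁} {o₂ : ManifoldOrientation d M₂}

theorem homInner_covDeriv_cofDiff_mul_density (hf : ContMDiff (𝓡 d) (𝓡 d) 2 f)
    (hx : x ∈ IsManifold.maximalAtlas (𝓡 d) ∞ M₁) (hy : y ∈ IsManifold.maximalAtlas (𝓡 d) ∞ M₂)
    (hxpos : IsPositiveChart o₁.orient x) (hypos : IsPositiveChart o₂.orient y)
    (hξ : IsC1Along f ξ) (hK : IsCompact (fieldSupport ξ))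
    (hsub : fieldSupport ξ ⊆ x.source ∩ f ⁻¹' y.source) (hu : u ∈ x.target) :
    homInner (covDeriv f ξ (x.symm u)) (cofDiff o₁ o₂ f (x.symm u)) * density x u =
      ∑ j, pd j (fluxRep f x y ξ j) u := by
  by_cases hmem : x.symm u ∈ fieldSupport ξ
  · have hdom : u ∈ coordDomain f x y := ⟨hu, (hsub hmem).2⟩
    rw [homInner_comm, sum_pd_fluxRep hf hx hy hξ hdom]
    exact homInner_cofDiff_covDeriv_eq_sum hx hy hxpos hypos hξ hdom
  · rw [covDeriv_eq_zero hmem, homInner_zero_left, zero_mul]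
    exact (Finset.sum_eq_zero fun j _ =>
      pd_fluxRep_eq_zero hK (fun _ hp => (hsub hp).1) (fun ⟨p, hp, hpu⟩ =>
        hmem (by rwa [← hpu, x.left_inv (hsub hp).1])) j).symm

open MeasureTheory

variable [MeasurableSpace M₁] [BorelSpace M₁]
  [IsContMDiffRiemannianBundle (𝓡 d) ∞ (Coord d) (fun p : M₁ => TangentSpace (𝓡 d) p)]

theorem integral_homInner_covDeriv_of_subset (hf : ContMDiff (𝓡 d) (𝓡 d) 2 f)
    (hx : x ∈ IsManifold.maximalAtlas (𝓡 d) ∞ M₁) (hy : y ∈ IsManifold.maximalAtlas (𝓡 d) ∞ M₂)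
    (hxpos : IsPositiveChart o₁.orient x) (hypos : IsPositiveChart o₂.orient y)
    (hξ : IsC1Along f ξ) (hK : IsCompact (fieldSupport ξ))
    (hsub : fieldSupport ξ ⊆ x.source ∩ f ⁻¹' y.source) :
    Integrable (fun p => homInner (covDeriv f ξ p) (cofDiff o₁ o₂ f p)) (riemVolume d M₁) ∧
      ∫ p, homInner (covDeriv f ξ p) (cofDiff o₁ o₂ f p) ∂(riemVolume d M₁) = 0 := by
  have hflux := contDiff_fluxRep hf hx hy hξ hK hsub
  have hfluxc := hasCompactSupport_fluxRep (y := y) hK (fun _ hp => (hsub hp).1)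
  have hdiv : Set.EqOn (fun u => homInner (covDeriv f ξ (x.symm u))
      (cofDiff o₁ o₂ f (x.symm u)) * density x u) (fun u => ∑ j, pd j (fluxRep f x y ξ j) u)
      x.target := fun u hu =>
    homInner_covDeriv_cofDiff_mul_density hf hx hy hxpos hypos hξ hK hsub hu
  have hzero (p : M₁) (hp : p ∉ fieldSupport ξ) :
      homInner (covDeriv f ξ p) (cofDiff o₁ o₂ f p) = 0 := by
    rw [covDeriv_eq_zero hp, homInner_zero_left]
  have hcont : ContinuousOn (fun p => homInner (covDeriv f ξ p) (cofDiff o₁ o₂ f p)) x.source :=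
    continuousOn_source_of_continuousOn_mul_density hx
      ((continuous_finsetSum _ fun j _ => continuous_pd (hflux j) j).continuousOn.congr hdiv)
  have hoff (u : Coord d) (hu : u ∉ x.target) (j : Fin d) : pd j (fluxRep f x y ξ j) u = 0 :=
    pd_fluxRep_eq_zero hK (fun _ hp => (hsub hp).1)
      (fun ⟨_, hp, hpu⟩ => hu (hpu ▸ x.map_source (hsub hp).1)) j
  constructor
  · rw [← integrableOn_iff_integrable_of_support_subset fun p hp =>
      (hsub (not_not.1 fun h => hp (hzero p h))).1, integrableOn_source_iff hx hcont,
      integrableOn_congr_fun hdiv x.open_target.measurableSet]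
    exact (integrable_finsetSum _ fun j _ => integrable_pd (hflux j) (hfluxc j) j).integrableOn
  · rw [← setIntegral_eq_integral_of_forall_compl_eq_zero fun p hp =>
      hzero p fun h => hp (hsub h).1, setIntegral_source hx hcont,
      setIntegral_congr_fun x.open_target.measurableSet hdiv,
      setIntegral_eq_integral_of_forall_compl_eq_zero fun u hu =>
        Finset.sum_eq_zero fun j _ => hoff u hu j]
    exact integral_sum_pd_eq_zero hflux hfluxc

end Flux

section PartitionOfUnity

theorem exists_smoothPartitionOfUnity_isSubordinate_of_isCompact {E H M : Type*}
    [NormedAddCommGroup E] [NormedSpace ℝ E] [FiniteDimensional ℝ E] [TopologicalSpace H]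
    {I : ModelWithCorners ℝ E H} [TopologicalSpace M] [ChartedSpace H M] [IsManifold I ∞ M]
    [T2Space M] {K : Set M} (hK : IsCompact K) {U : M → Set M} (hU : ∀ p ∈ K, U p ∈ nhds p) :
    ∃ (t : Finset K) (ρ : SmoothPartitionOfUnity t I M K), ρ.IsSubordinate fun p => U p := by
  have hbump (p : K) : ∃ φ : SmoothBumpFunction I (p : M), tsupport φ ⊆ U p := by
    simpa using (SmoothBumpFunction.nhds_basis_tsupport (I := I) (p : M)).mem_iff.1 (hU p p.2)
  choose φ hφ using hbump
  obtain ⟨t, ht⟩ := hK.elim_nhds_subcover' (fun p hp => {q | φ ⟨p, hp⟩ =ᶠ[nhds q] 1})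
    fun p hp => eventually_eventually_nhds.2 (φ ⟨p, hp⟩).eventuallyEq_one
  let bumps : SmoothBumpCovering t I M K :=
    { c := fun p => p
      toFun := fun p => φ p
      c_mem' := fun p => p.1.2
      locallyFinite' := locallyFinite_of_finite _
      eventuallyEq_one' := fun q hq => by
        obtain ⟨p, hp, hpq⟩ := Set.mem_iUnion₂.1 (ht hq)
        exact ⟨⟨p, hp⟩, hpq⟩ }
  have hbumps : bumps.IsSubordinate U := fun p => hφ p
  exact ⟨t, bumps.toSmoothPartitionOfUnity, hbumps.toSmoothPartitionOfUnity⟩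

variable {d : ℕ} {M₁ M₂ : Type*} [TopologicalSpace M₁] [ChartedSpace (Coord d) M₁]
  [TopologicalSpace M₂] [ChartedSpace (Coord d) M₂] {f : M₁ → M₂}

theorem sum_smoothPartitionOfUnity_smul {ι : Type*} [Fintype ι] {K : Set M₁}
    (ρ : SmoothPartitionOfUnity ι (𝓡 d) M₁ K) {ξ : ∀ p, TangentSpace (𝓡 d) (f p)}
    (hξ : fieldSupport ξ ⊆ K) : (fun p => ∑ i, ρ i p • ξ p) = ξ := by
  funext p
  by_cases hp : p ∈ fieldSupport ξ
  · rw [← Finset.sum_smul, ← finsum_eq_sum_of_fintype, ρ.sum_eq_one (hξ hp), one_smul]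
  · simp only [eq_zero_of_notMem_fieldSupport hp, smul_zero, Finset.sum_const_zero]

end PartitionOfUnity

section WeakIdentity

open MeasureTheory

variable {d : ℕ} [NeZero d] {M₁ M₂ : Type*}
  [TopologicalSpace M₁] [T2Space M₁] [ChartedSpace (Coord d) M₁] [IsManifold (𝓡 d) ∞ M₁]
  [MeasurableSpace M₁] [BorelSpace M₁] [RiemannianBundle (fun p : M₁ => TangentSpace (𝓡 d) p)]
  [IsContMDiffRiemannianBundle (𝓡 d) ∞ (Coord d) (fun p : M₁ => TangentSpace (𝓡 d) p)]
  [TopologicalSpace M₂] [ChartedSpace (Coord d) M₂] [IsManifold (𝓡 d) ∞ M₂]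
  [RiemannianBundle (fun p : M₂ => TangentSpace (𝓡 d) p)]
  [IsContMDiffRiemannianBundle (𝓡 d) ∞ (Coord d) (fun p : M₂ => TangentSpace (𝓡 d) p)]
  {f : M₁ → M₂}

theorem riemannianPiolaOn_univ (o₁ : ManifoldOrientation d M₁) (o₂ : ManifoldOrientation d M₂)
    (hf : ContMDiff (𝓡 d) (𝓡 d) 2 f) : RiemannianPiolaOn o₁ o₂ f Set.univ := by
  intro ξ hξ hK _
  choose x hx hpx hxpos using o₁.exists_positive
  choose y hy hqy hypos using o₂.exists_positive
  have hnhds (p : M₁) : (x p).source ∩ f ⁻¹' (y (f p)).source ∈ nhds p :=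
    Filter.inter_mem ((x p).open_source.mem_nhds (hpx p))
      (hf.continuous.continuousAt.preimage_mem_nhds ((y (f p)).open_source.mem_nhds (hqy (f p))))
  obtain ⟨t, ρ, hρ⟩ := exists_smoothPartitionOfUnity_isSubordinate_of_isCompact (I := 𝓡 d) hK
    fun p _ => hnhds p
  have hpiece (i : t) : IsC1Along f (fun p => ρ i p • ξ p) :=
    hξ.smul ((ρ i).contMDiff.of_le (by norm_cast))
  have hlocal (i : t) := integral_homInner_covDeriv_of_subset hf (hx i) (hy (f i)) (hxpos i)
    (hypos (f i)) (hpiece i)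
    (hK.of_isClosed_subset isClosed_closure fun _ hp => (fieldSupport_smul_subset (ρ i) ξ hp).1)
    fun _ hp => hρ i (fieldSupport_smul_subset (ρ i) ξ hp).2
  have hsum (p : M₁) : homInner (covDeriv f ξ p) (cofDiff o₁ o₂ f p) =
      ∑ i, homInner (covDeriv f (fun q => ρ i q • ξ q) p) (cofDiff o₁ o₂ f p) := by
    rw [← homInner_sum_left, ← covDeriv_sum Finset.univ hpiece,
      sum_smoothPartitionOfUnity_smul ρ subset_rfl]
  simp only [hsum, inner_zero_right, integral_zero]
  rw [integral_finsetSum _ fun i _ => (hlocal i).1]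
  exact (Finset.sum_eq_zero fun i _ => (hlocal i).2).symm

end WeakIdentity

section Identity

variable {d : ℕ} {M : Type*} [TopologicalSpace M] {x : OpenPartialHomeomorph M (Coord d)}
  {u : Coord d}

theorem jacobian_id (u : Coord d) : jacobian id u = 1 := by
  ext α i
  have hcomponent := fderiv_component
    (differentiableAt_id : DifferentiableAt ℝ (id : Coord d → Coord d) u) α (stdVec i)
  rw [fderiv_id] at hcomponent
  exact hcomponent.trans (by simp [stdVec_apply, Matrix.one_apply])

theorem jac_id_self (hu : u ∈ x.target) : jac id x x u = 1 := by
  rw [← jacobian_id u]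
  ext α i
  have hcoordRep : (fun w => coordRep id x x w α) =ᶠ[nhds u] fun w => w α :=
    Filter.eventuallyEq_of_mem (x.open_target.mem_nhds hu) fun w hw =>
      congrArg (fun v : Coord d => v α) (x.right_inv hw)
  exact congrArg (· (stdVec i)) (hcoordRep.fderiv_eq (𝕜 := ℝ))

variable [ChartedSpace (Coord d) M] [RiemannianBundle (fun p : M => TangentSpace (𝓡 d) p)]

theorem divDensityCof_id_self (hu : u ∈ x.target) (γ : Fin d) :
    divDensityCof id x x γ u = pd γ (density x) u := by
  have hpd (j : Fin d) : pd j (fun w => (matCof (jac id x x w))ᵀ j γ * pullDensity id x x w) u =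
      (1 : Matrix (Fin d) (Fin d) ℝ) j γ * pd j (density x) u := by
    have hproduct : (fun w => (matCof (jac id x x w))ᵀ j γ * pullDensity id x x w) =ᶠ[nhds u]
        fun w => (1 : Matrix (Fin d) (Fin d) ℝ) j γ * density x w :=
      Filter.eventuallyEq_of_mem (x.open_target.mem_nhds hu) fun w hw => by
        simp only [jac_id_self hw, matCof, Matrix.adjugate_one, Matrix.transpose_one, pullDensity,
          coordRep, id_eq, x.right_inv hw]
    exact congrArg (· (stdVec j)) ((hproduct.fderiv_eq (𝕜 := ℝ)).trans
      (congrFun (fderiv_const_smul_field ((1 : Matrix (Fin d) (Fin d) ℝ) j γ)) u))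
  rw [divDensityCof, Finset.sum_congr rfl fun j _ => hpd j, Finset.sum_eq_single γ]
  · rw [Matrix.one_apply_eq, one_mul]
  · intro j _ hj
    rw [Matrix.one_apply_ne hj, zero_mul]
  · simp

end Identity

section Euclidean

variable {d : ℕ}

theorem refl_mem_maximalAtlas : OpenPartialHomeomorph.refl (Coord d) ∈
    IsManifold.maximalAtlas (𝓡 d) ∞ (Coord d) :=
  (IsManifold.mem_maximalAtlas_iff_contMDiffOn _).2 ⟨contMDiffOn_id, contMDiffOn_id⟩

theorem gram_refl (v : Coord d) : gram (OpenPartialHomeomorph.refl (Coord d)) v = 1 := by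
  have hframe (α : Fin d) : frame (OpenPartialHomeomorph.refl (Coord d)) v α = stdVec α := by
    change (mfderiv (𝓡 d) (𝓡 d) id v).inverse (stdVec α) = _
    rw [mfderiv_id]
    exact congrArg (· (stdVec α)) (ContinuousLinearMap.inverse_id (R := ℝ) (M := Coord d))
  ext α β
  change inner ℝ (frame (OpenPartialHomeomorph.refl (Coord d)) v α)
    (frame (OpenPartialHomeomorph.refl (Coord d)) v β) = _
  rw [hframe, hframe]
  rw [Matrix.one_apply]
  refine Eq.trans ?_
    (orthonormal_iff_ite.1 (EuclideanSpace.basisFun (Fin d) ℝ).orthonormal α β)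
  rw [EuclideanSpace.basisFun_apply, EuclideanSpace.basisFun_apply]
  rfl

theorem density_eq_abs_det_fderiv_symm {y : OpenPartialHomeomorph (Coord d) (Coord d)}
    (hy : y ∈ IsManifold.maximalAtlas (𝓡 d) ∞ (Coord d)) {v : Coord d} (hv : v ∈ y.target) :
    density y v = |(fderiv ℝ y.symm v).det| := by
  have hdensity : density (OpenPartialHomeomorph.refl (Coord d)) (y.symm v) = 1 := by
    rw [density, gram_refl, Matrix.det_one, Real.sqrt_one]
  exact (density_transition refl_mem_maximalAtlas hy hv (Set.mem_univ _)).trans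
    ((congrArg (_ * ·) hdensity).trans (mul_one _))

theorem hasFDerivAt_coord (α : Fin d) (v : Coord d) :
    HasFDerivAt (fun w : Coord d => w α) (EuclideanSpace.proj α : Coord d →L[ℝ] ℝ) v :=
  (EuclideanSpace.proj α : Coord d →L[ℝ] ℝ).hasFDerivAt

variable [NeZero d]

/-- The map that replaces the first coordinate `v₀` of `v` by `φ v₀`. -/
def mapFirst (φ : ℝ → ℝ) (v : Coord d) : Coord d := v + (φ (v 0) - v 0) • stdVec 0

theorem mapFirst_leftInverse {φ ψ : ℝ → ℝ} (h : Function.LeftInverse ψ φ) :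
    Function.LeftInverse (mapFirst ψ : Coord d → Coord d) (mapFirst φ) := by
  intro v
  ext α
  obtain rfl | hα := eq_or_ne α 0
  · simp [mapFirst, stdVec_apply, h (v 0)]
  · simp [mapFirst, stdVec_apply, hα]

theorem contDiff_mapFirst {n : WithTop ℕ∞} {φ : ℝ → ℝ} (hφ : ContDiff ℝ n φ) :
    ContDiff ℝ n (mapFirst φ : Coord d → Coord d) := by
  have hcoord : ContDiff ℝ n fun v : Coord d => v 0 := contDiff_euclidean.1 contDiff_id 0
  exact contDiff_id.add (((hφ.comp hcoord).sub hcoord).smul contDiff_const)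

theorem det_fderiv_mapFirst {φ : ℝ → ℝ} {φ' : ℝ} {v : Coord d} (hφ : HasDerivAt φ φ' (v 0)) :
    (fderiv ℝ (mapFirst φ) v).det = φ' := by
  have hcoord := hasFDerivAt_coord 0 v
  have hfderiv : HasFDerivAt (mapFirst φ) _ v := (hasFDerivAt_id v).fun_add
    (((hφ.comp_hasFDerivAt v hcoord).fun_sub hcoord).smul_const (stdVec (0 : Fin d)))
  let dφ : Coord d →ₗ[ℝ] ℝ := (φ' - 1) • (EuclideanSpace.proj 0 : Coord d →L[ℝ] ℝ)
  have htransvection : (fderiv ℝ (mapFirst φ) v : Coord d →ₗ[ℝ] Coord d) =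
      LinearMap.transvection dφ (stdVec 0) := by
    rw [hfderiv.fderiv]
    ext a : 1
    simp [dφ, LinearMap.transvection.apply, sub_mul]
  rw [ContinuousLinearMap.det, htransvection, LinearMap.transvection.det]
  simp [dφ, stdVec_apply]

variable (d) in
/-- The chart of `ℝᵈ` whose inverse is `v ↦ (sinh v₀, v₁, …)`. -/
def sinhChart : OpenPartialHomeomorph (Coord d) (Coord d) :=
  (Homeomorph.toOpenPartialHomeomorph
    { toFun := mapFirst Real.arsinh
      invFun := mapFirst Real.sinh
      left_inv := mapFirst_leftInverse Real.sinh_arsinh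
      right_inv := mapFirst_leftInverse Real.arsinh_sinh
      continuous_toFun := (contDiff_mapFirst (n := 0) Real.contDiff_arsinh).continuous
      continuous_invFun := (contDiff_mapFirst (n := 0) Real.contDiff_sinh).continuous })

theorem sinhChart_mem_maximalAtlas :
    sinhChart d ∈ IsManifold.maximalAtlas (𝓡 d) ∞ (Coord d) :=
  (IsManifold.mem_maximalAtlas_iff_contMDiffOn _).2
    ⟨(contDiff_mapFirst Real.contDiff_arsinh).contMDiff.contMDiffOn,
      (contDiff_mapFirst Real.contDiff_sinh).contMDiff.contMDiffOn⟩

theorem density_sinhChart (v : Coord d) : density (sinhChart d) v = Real.cosh (v 0) := by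
  rw [density_eq_abs_det_fderiv_symm sinhChart_mem_maximalAtlas (Set.mem_univ v)]
  exact (congrArg abs (det_fderiv_mapFirst (Real.hasDerivAt_sinh (v 0)))).trans 
    (abs_of_pos (Real.cosh_pos _))

theorem divDensityCof_sinhChart (v : Coord d) :
    divDensityCof id (sinhChart d) (sinhChart d) 0 v = Real.sinh (v 0) := by
  have hcosh : HasFDerivAt (fun w : Coord d => Real.cosh (w 0))
      (Real.sinh (v 0) • (EuclideanSpace.proj 0 : Coord d →L[ℝ] ℝ)) v :=
    (Real.hasDerivAt_cosh (v 0)).comp_hasFDerivAt (f := fun w : Coord d => w 0) v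
      (hasFDerivAt_coord 0 v)
  rw [divDensityCof_id_self (Set.mem_univ v), funext density_sinhChart, pd, hcosh.fderiv]
  simp [stdVec_apply]

end Euclidean

end Piola

end

theorem mainTheorem11_general {d : ℕ} [NeZero d] {M₁ M₂ : Type*}
    [TopologicalSpace M₁] [T2Space M₁]
    [ChartedSpace (Coord d) M₁] [IsManifold (𝓡 d) ∞ M₁]
    [RiemannianBundle (fun p : M₁ => TangentSpace (𝓡 d) p)]
    [IsContMDiffRiemannianBundle (𝓡 d) ∞ (Coord d) (fun p : M₁ => TangentSpace (𝓡 d) p)]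
    [MeasurableSpace M₁] [BorelSpace M₁]
    [TopologicalSpace M₂]
    [ChartedSpace (Coord d) M₂] [IsManifold (𝓡 d) ∞ M₂]
    [RiemannianBundle (fun p : M₂ => TangentSpace (𝓡 d) p)]
    [IsContMDiffRiemannianBundle (𝓡 d) ∞ (Coord d) (fun p : M₂ => TangentSpace (𝓡 d) p)]
    (o₁ : ManifoldOrientation d M₁) (o₂ : ManifoldOrientation d M₂)
    (f : M₁ → M₂) (hf : ContMDiff (𝓡 d) (𝓡 d) 2 f) :
    (∀ x ∈ IsManifold.maximalAtlas (𝓡 d) ∞ M₁, ∀ y ∈ IsManifold.maximalAtlas (𝓡 d) ∞ M₂,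
      (RiemannianPiolaOn o₁ o₂ f (x.source ∩ f ⁻¹' y.source) ↔
        ∀ u ∈ coordDomain f x y, ∀ γ, coordPiola f x y γ u = 0) ∧
      (∀ u ∈ coordDomain f x y, ∀ γ, coordPiola f x y γ u = - divCof f x y γ u) ∧
      ((∀ u ∈ coordDomain f x y, ∀ γ, coordPiola f x y γ u = 0) ↔
        ∀ u ∈ coordDomain f x y, ∀ γ, divCof f x y γ u = 0) ∧
      (∀ u ∈ coordDomain f x y, ∀ γ, divCof f x y γ u = 0) ∧
      (∀ u ∈ coordDomain f x y, ∀ γ, divDensityCof f x y γ u =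
        pullDensity f x y u * (pullTraceChristoffel f x y γ u * (jac f x y u).det)) ∧
      (∀ u ∈ coordDomain f x y, ∀ γ, (divDensityCof f x y γ u = 0 ↔
        pullTraceChristoffel f x y γ u = 0 ∨ (jac f x y u).det = 0)) ∧
      (IsPositiveChart o₁.orient x → IsPositiveChart o₂.orient y →
        ∀ ξ : ∀ p, TangentSpace (𝓡 d) (f p), IsC1Along f ξ → ∀ u ∈ coordDomain f x y,
          homInner (cofDiff o₁ o₂ f (x.symm u)) (covDeriv f ξ (x.symm u)) * density x u =
            ∑ γ, ((∑ j, (matCof (jac f x y u))ᵀ j γ *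
                pd j (fun w => comp y (f (x.symm w)) γ (ξ (x.symm w))) u) +
              pullTraceChristoffel f x y γ u * (jac f x y u).det *
                comp y (f (x.symm u)) γ (ξ (x.symm u))) * pullDensity f x y u)) ∧
    RiemannianPiolaOn o₁ o₂ f Set.univ ∧
    (∃ x ∈ IsManifold.maximalAtlas (𝓡 d) ∞ (Coord d),
      ∃ y ∈ IsManifold.maximalAtlas (𝓡 d) ∞ (Coord d),
        ∃ u ∈ coordDomain (id : Coord d → Coord d) x y, ∃ γ,
          divDensityCof (id : Coord d → Coord d) x y γ u ≠ 0) := by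
  have hpiola {x : OpenPartialHomeomorph M₁ (Coord d)} {y : OpenPartialHomeomorph M₂ (Coord d)}
      (hx : x ∈ IsManifold.maximalAtlas (𝓡 d) ∞ M₁) (hy : y ∈ IsManifold.maximalAtlas (𝓡 d) ∞ M₂)
      {u : Coord d} (hu : u ∈ coordDomain f x y) (γ : Fin d) : coordPiola f x y γ u = 0 := by
    rw [coordPiola_eq_neg_divCof hf hx hy hu, divCof_eq_zero hf hx hy hu, neg_zero]
  refine ⟨fun x hx y hy => ⟨?_, ?_, ?_, ?_, ?_, ?_, ?_⟩, riemannianPiolaOn_univ o₁ o₂ hf, ?_⟩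
  · exact ⟨fun _ u hu γ => hpiola hx hy hu γ, fun _ ξ hξ hK _ =>
      riemannianPiolaOn_univ o₁ o₂ hf ξ hξ hK (Set.subset_univ _)⟩
  · exact fun u hu γ => coordPiola_eq_neg_divCof hf hx hy hu γ
  · refine forall₃_congr fun u hu γ => ?_
    rw [coordPiola_eq_neg_divCof hf hx hy hu, neg_eq_zero]
  · exact fun u hu γ => divCof_eq_zero hf hx hy hu γ
  · exact fun u hu γ => divDensityCof_eq hf hx hy hu γ
  · exact fun u hu γ => divDensityCof_eq_zero_iff hf hx hy hu γ
  · exact fun hxpos hypos ξ hξ u hu => homInner_cofDiff_covDeriv_eq_sum hx hy hxpos hypos hξ hu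
  · refine ⟨sinhChart d, sinhChart_mem_maximalAtlas, sinhChart d, sinhChart_mem_maximalAtlas,
      stdVec 0, ⟨Set.mem_univ _, Set.mem_univ _⟩, 0, ?_⟩
    rw [divDensityCof_sinhChart]
    simp [stdVec_apply]

theorem mainTheorem11 {d : ℕ} [NeZero d] {M₁ M₂ : Type*}
    [TopologicalSpace M₁] [T2Space M₁] [SecondCountableTopology M₁]
    [ChartedSpace (Coord d) M₁] [IsManifold (𝓡 d) ∞ M₁]
    [RiemannianBundle (fun p : M₁ => TangentSpace (𝓡 d) p)]
    [IsContMDiffRiemannianBundle (𝓡 d) ∞ (Coord d) (fun p : M₁ => TangentSpace (𝓡 d) p)]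
    [MeasurableSpace M₁] [BorelSpace M₁]
    [TopologicalSpace M₂] [T2Space M₂] [SecondCountableTopology M₂]
    [ChartedSpace (Coord d) M₂] [IsManifold (𝓡 d) ∞ M₂]
    [RiemannianBundle (fun p : M₂ => TangentSpace (𝓡 d) p)]
    [IsContMDiffRiemannianBundle (𝓡 d) ∞ (Coord d) (fun p : M₂ => TangentSpace (𝓡 d) p)]
    (o₁ : ManifoldOrientation d M₁) (o₂ : ManifoldOrientation d M₂)
    (f : M₁ → M₂) (hf : ContMDiff (𝓡 d) (𝓡 d) 2 f) :
    -- statements in arbitrary local coordinates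
    (∀ x ∈ IsManifold.maximalAtlas (𝓡 d) ∞ M₁, ∀ y ∈ IsManifold.maximalAtlas (𝓡 d) ∞ M₂,
      -- the Piola identity is equivalent to the coordinate identity with the connection term
      (RiemannianPiolaOn o₁ o₂ f (x.source ∩ f ⁻¹' y.source) ↔
        ∀ u ∈ coordDomain f x y, ∀ γ, coordPiola f x y γ u = 0) ∧
      -- which reduces to the metric-free identity
      (∀ u ∈ coordDomain f x y, ∀ γ, coordPiola f x y γ u = - divCof f x y γ u) ∧
      ((∀ u ∈ coordDomain f x y, ∀ γ, coordPiola f x y γ u = 0) ↔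
        ∀ u ∈ coordDomain f x y, ∀ γ, divCof f x y γ u = 0) ∧
      -- and this identity holds
      (∀ u ∈ coordDomain f x y, ∀ γ, divCof f x y γ u = 0) ∧
      -- the expression without connection term does not vanish in general
      (∀ u ∈ coordDomain f x y, ∀ γ, divDensityCof f x y γ u =
        pullDensity f x y u * (pullTraceChristoffel f x y γ u * (jac f x y u).det)) ∧
      (∀ u ∈ coordDomain f x y, ∀ γ, (divDensityCof f x y γ u = 0 ↔
        pullTraceChristoffel f x y γ u = 0 ∨ (jac f x y u).det = 0)) ∧
      -- in positive coordinates, the integrand of the weak form of the Piola identity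
      (IsPositiveChart o₁.orient x → IsPositiveChart o₂.orient y →
        ∀ ξ : ∀ p, TangentSpace (𝓡 d) (f p), IsC1Along f ξ → ∀ u ∈ coordDomain f x y,
          homInner (cofDiff o₁ o₂ f (x.symm u)) (covDeriv f ξ (x.symm u)) * density x u =
            ∑ γ, ((∑ j, (matCof (jac f x y u))ᵀ j γ *
                pd j (fun w => comp y (f (x.symm w)) γ (ξ (x.symm w))) u) +
              pullTraceChristoffel f x y γ u * (jac f x y u).det *
                comp y (f (x.symm u)) γ (ξ (x.symm u))) * pullDensity f x y u)) ∧
    -- the Piola identity holds on all of `M₁`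
    RiemannianPiolaOn o₁ o₂ f Set.univ ∧
    -- the formula without connection term fails already in Euclidean space
    (∃ x ∈ IsManifold.maximalAtlas (𝓡 d) ∞ (Coord d),
      ∃ y ∈ IsManifold.maximalAtlas (𝓡 d) ∞ (Coord d),
        ∃ u ∈ coordDomain (id : Coord d → Coord d) x y, ∃ γ,
          divDensityCof (id : Coord d → Coord d) x y γ u ≠ 0) :=
  mainTheorem11_general o₁ o₂ f hf
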